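/- For a graph $H$ and a function $p = p(n) \in [0,1]$, let the chromatic threshold $\delta_\chi(H,p)$ of $H$ with respect to $p$ be the infimum of all $d > 0$ for which there exists a constant $C > 0$ (not depending on $n$) such that, with probability tending to $1$ as $n \to \infty$, every $H$-free spanning subgraph $G$ of the binomial random graph $G(n,p)$ with minimum degree $\delta(G) \ge d\,p\,n$ satisfies $\chi(G) \le C$. Here $H$-free means containing no (not necessarily induced) copy of $H$. Let $k \ge 2$ be an integer, and suppose that $p = p(n) \in [0,1]$ satisfies $$\frac{(\log n)^2}{n} \,\le\, p(n)$$ for all sufficiently large $n$, and $p(n) = o\big( n^{-(2k-3)/(2k-2)} \big)$ as $n \to \infty$. Then $$\delta_\chi(C_{2k+1}, p) \,\ge\, \frac{1}{2},$$ where $C_{2k+1}$ is the cycle of length $2k+1$. -/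

import Mathlib

open Filter Topology Asymptotics

open scoped Classical in
/-- The event that every spanning subgraph `G` of `Γ` which contains no copy of `H` and has
minimum degree at least `m` has chromatic number at most `C`. -/
def BoundedChromaticEvent {W : Type*} (H : SimpleGraph W) (n : ℕ) (m : ℝ) (C : ℕ) :
    Set (SimpleGraph (Fin n)) :=
  {Γ | ∀ G : SimpleGraph (Fin n), G ≤ Γ → H.Free G → m ≤ (G.minDegree : ℝ) →
    G.chromaticNumber ≤ (C : ℕ∞)}

/-- The chromatic threshold `δ_χ(H, p)` of `H` with respect to `p = p(n) ∈ [0, 1]`: the infimum of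
those `d > 0` for which there is a constant `C > 0`, independent of `n`, such that with probability
tending to `1` every `H`-free spanning subgraph `G` of the binomial random graph `G(n, p(n))` with
minimum degree at least `d * p(n) * n` has chromatic number at most `C`. -/
noncomputable def chromaticThreshold {W : Type*} (H : SimpleGraph W) (p : ℕ → unitInterval) : ℝ :=
  sInf {d : ℝ | 0 < d ∧ ∃ C : ℕ, 0 < C ∧
    Tendsto (fun n : ℕ => SimpleGraph.binomialRandom (Fin n) (p n)
      (BoundedChromaticEvent H n (d * (p n : ℝ) * (n : ℝ)) C)) atTop (𝓝 1)}

/-! For every `d < 1/2` and every `C`, the random graph contains, with probability at least 1/2, a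
`C_{2k+1}`-free subgraph of minimum degree at least `d p n` that is not `C`-colourable; so no `d <
1/2` is admissible.

Split the vertices into a set `X` of about `K / p` vertices, with `K = 128 C ^ 2`, and two sets `U`,
`W` of about `n / 2` vertices each. Inside `X` the expected degrees are bounded, yet no set of about
`|X| / (4C)` vertices is independent. Few vertices of `X` have degree above a constant `D` or lie on
a `(2k+1)`-cycle inside `X`; the rest, the core, has more than `|X| / 2` vertices and is not
`C`-colourable. The `base` graph adds the edges between `U` and `W`, and those between `X` and the
vertices of `U` with at most `D'` neighbours in `X`. An odd cycle in it has an edge inside `X`,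
since otherwise it would alternate between `U` and its complement (`exists_two_mem_X`). Hence a
`(2k+1)`-cycle that meets `W` contains a step from `W` through `U` to `X`, and one that meets `U`
but not `W` contains two vertices of `X` followed by one of `U`. Cutting one edge of each such
pattern destroys all of them (`cycleGraph_free_final`) and leaves the core intact.

It remains to see that each vertex loses only a small fraction of `p n` edges. A cut edge closes a
walk of length `2k - 1` with a step of bounded degree, so from a given start there are only `O((p n)
^ (2k - 2))` possible ends; by the upper bound on `p` this is `o(n)` (`eventually_pow_le`). These
ends do not depend on the star at the vertex in question, so few neighbours fall among them
(`graphProb_cutStar_nbrIn_le`). At `w ∈ W` both ends of the walk are neighbours of `w`; the walk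
then has two steps of bounded degree, and the factor gained pays for the choice of the first
neighbour (`bernProb_related_le`). The lower bound on `p` makes the exponential tails beat the union
bounds over vertices and pairs. -/

/-! ### Random subsets and exponential tail bounds. -/

section RandomSubset

open scoped Classical

variable {α β : Type*} [DecidableEq α] [DecidableEq β]

/-- The expectation of `f s`, where `s` is a random subset of `E` that contains each element
independently with probability `p`. -/
noncomputable def bernExp (E : Finset α) (p : ℝ) (f : Finset α → ℝ) : ℝ :=
  ∑ s ∈ E.powerset, p ^ s.card * (1 - p) ^ (E \ s).card * f s

/-- The probability that a `p`-random subset of `E` satisfies `Q`. -/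
noncomputable def bernProb (E : Finset α) (p : ℝ) (Q : Finset α → Prop) : ℝ :=
  bernExp E p fun s => if Q s then 1 else 0

variable {E : Finset α} {p : ℝ} {f g : Finset α → ℝ}

lemma bernExp_mono (h0 : 0 ≤ p) (h1 : p ≤ 1) (h : ∀ s ⊆ E, f s ≤ g s) :
    bernExp E p f ≤ bernExp E p g := by
  refine Finset.sum_le_sum fun s hs => ?_
  have h2 : 0 ≤ 1 - p := by linarith
  exact mul_le_mul_of_nonneg_left (h s (Finset.mem_powerset.1 hs)) (by positivity)

lemma bernExp_congr (h : ∀ s ⊆ E, f s = g s) : bernExp E p f = bernExp E p g :=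
  Finset.sum_congr rfl fun s hs => by rw [h s (Finset.mem_powerset.1 hs)]

lemma bernExp_const_mul (c : ℝ) : bernExp E p (fun s => c * f s) = c * bernExp E p f := by
  simp only [bernExp, Finset.mul_sum]
  exact Finset.sum_congr rfl fun s _ => by ring

lemma bernExp_add : bernExp E p (fun s => f s + g s) = bernExp E p f + bernExp E p g := by
  simp only [bernExp, ← Finset.sum_add_distrib]
  exact Finset.sum_congr rfl fun s _ => by ring

lemma bernExp_insert {a : α} (ha : a ∉ E) :
    bernExp (insert a E) p f =
      (1 - p) * bernExp E p f + p * bernExp E p (fun s => f (insert a s)) := by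
  unfold bernExp
  rw [Finset.sum_powerset_insert ha, Finset.mul_sum, Finset.mul_sum]
  congr 1
  · refine Finset.sum_congr rfl fun s hs => ?_
    have hs' := Finset.mem_powerset.1 hs
    have : a ∉ s := fun h => ha (hs' h)
    rw [Finset.insert_sdiff_of_notMem _ this, Finset.card_insert_of_notMem (by simp [ha])]
    ring
  · refine Finset.sum_congr rfl fun s hs => ?_
    have hs' := Finset.mem_powerset.1 hs
    have h : a ∉ s := fun h => ha (hs' h)
    rw [Finset.card_insert_of_notMem h, Finset.insert_sdiff_insert,
      Finset.sdiff_insert_of_notMem ha]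
    ring

lemma bernExp_prod (u v : α → ℝ) :
    bernExp E p (fun s => (∏ i ∈ s, u i) * ∏ i ∈ E \ s, v i) =
      ∏ i ∈ E, (p * u i + (1 - p) * v i) := by
  rw [Finset.prod_add]
  refine Finset.sum_congr rfl fun s _ => ?_
  rw [Finset.prod_mul_distrib, Finset.prod_mul_distrib, Finset.prod_const, Finset.prod_const]
  ring

lemma bernExp_prod_mem (u : α → ℝ) :
    bernExp E p (fun s => ∏ i ∈ s, u i) = ∏ i ∈ E, (p * u i + (1 - p)) := by
  simpa using bernExp_prod (E := E) (p := p) u (fun _ => 1)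

lemma bernExp_one : bernExp E p (fun _ => 1) = 1 := by
  simpa using bernExp_prod_mem (E := E) (p := p) (fun _ => 1)

/-- Independence of the random set on disjoint ground sets, in the form of iterated expectation. -/
lemma bernExp_union {E' : Finset α} (h : Disjoint E E') :
    bernExp (E ∪ E') p f = bernExp E p (fun s => bernExp E' p (fun t => f (s ∪ t))) := by
  induction E' using Finset.induction_on generalizing f with
  | empty => simp [bernExp]
  | insert a E' ha ih =>
    have hd : Disjoint E E' := h.mono_right (Finset.subset_insert a E')
    have haE : a ∉ E := fun h' => (Finset.disjoint_left.1 h) h' (Finset.mem_insert_self a E')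
    rw [Finset.union_insert, bernExp_insert (by simp [ha, haE]), ih hd, ih hd]
    simp only [bernExp_insert ha, bernExp_add, bernExp_const_mul, Finset.union_insert]

lemma bernExp_map (e : α ↪ β) (f : Finset β → ℝ) :
    bernExp (E.map e) p f = bernExp E p (fun s => f (s.map e)) := by
  induction E using Finset.induction_on generalizing f with
  | empty => simp [bernExp]
  | insert a E ha ih =>
    rw [Finset.map_insert, bernExp_insert (by simpa using ha), bernExp_insert ha, ih, ih]
    simp only [Finset.map_insert]

variable {Q R : Finset α → Prop}

lemma bernProb_mono (h0 : 0 ≤ p) (h1 : p ≤ 1) (h : ∀ s ⊆ E, Q s → R s) :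
    bernProb E p Q ≤ bernProb E p R := by
  refine bernExp_mono h0 h1 fun s hs => ?_
  by_cases hQ : Q s
  · simp [hQ, h s hs hQ]
  · simp only [hQ, if_false]; split_ifs <;> norm_num

lemma bernProb_or_le (h0 : 0 ≤ p) (h1 : p ≤ 1) :
    bernProb E p (fun s => Q s ∨ R s) ≤ bernProb E p Q + bernProb E p R := by
  unfold bernProb
  rw [← bernExp_add]
  refine bernExp_mono h0 h1 fun s _ => ?_
  by_cases hQ : Q s <;> by_cases hR : R s <;> simp [hQ, hR]

/-- The exponential Markov inequality for random subsets. -/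
lemma bernProb_le_exp_mul (h0 : 0 ≤ p) (h1 : p ≤ 1) (φ : Finset α → ℝ) (t : ℝ)
    (hQ : ∀ s ⊆ E, Q s → t ≤ φ s) :
    bernProb E p Q ≤ Real.exp (-t) * bernExp E p (fun s => Real.exp (φ s)) := by
  rw [← bernExp_const_mul]
  refine bernExp_mono h0 h1 fun s hs => ?_
  rw [← Real.exp_add]
  split_ifs with h
  · exact Real.one_le_exp (by linarith [hQ s hs h])
  · positivity

/-- The exponential is a product over elements, so the expectation factorises; `1 + x ≤ exp x`
bounds each factor. -/
lemma bernExp_exp_mul_card_inter (h0 : 0 ≤ p) (h1 : p ≤ 1) (T : Finset α) (l : ℝ) :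
    bernExp E p (fun s => Real.exp (l * ((s ∩ T).card : ℝ))) ≤
      Real.exp (p * (Real.exp l - 1) * ((E ∩ T).card : ℝ)) := by
  have key : ∀ s : Finset α, Real.exp (l * ((s ∩ T).card : ℝ)) =
      ∏ i ∈ s, (if i ∈ T then Real.exp l else 1) := fun s => by
    rw [← Finset.prod_filter, Finset.filter_mem_eq_inter, Finset.prod_const, ← Real.exp_nat_mul,
      mul_comm]
  simp only [key, bernExp_prod_mem]
  have h2 : ∀ i ∈ E, p * (if i ∈ T then Real.exp l else 1) + (1 - p) ≤
      if i ∈ T then Real.exp (p * (Real.exp l - 1)) else 1 := fun i _ => by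
    split_ifs
    · linarith [Real.add_one_le_exp (p * (Real.exp l - 1))]
    · linarith
  refine (Finset.prod_le_prod (fun i _ => ?_) h2).trans_eq ?_
  · split_ifs
    · have := Real.exp_pos l
      nlinarith
    · linarith
  · rw [← Finset.prod_filter, Finset.filter_mem_eq_inter, Finset.prod_const, ← Real.exp_nat_mul,
      mul_comm]

lemma exp_one_sub_one_le_two : Real.exp 1 - 1 ≤ 2 := by
  linarith [Real.exp_one_lt_d9]

/-- Upper tail of the number of elements of `T` in a random set. -/
lemma bernProb_card_inter_ge_le (h0 : 0 ≤ p) (h1 : p ≤ 1) (T : Finset α) (t : ℝ) :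
    bernProb E p (fun s => t ≤ ((s ∩ T).card : ℝ)) ≤ Real.exp (-t + 2 * p * (T.card : ℝ)) := by
  refine (bernProb_le_exp_mul h0 h1 (fun s => 1 * ((s ∩ T).card : ℝ)) t
    fun s _ h => by simpa using h).trans ?_
  rw [Real.exp_add]
  refine mul_le_mul_of_nonneg_left ((bernExp_exp_mul_card_inter h0 h1 T 1).trans ?_)
    (Real.exp_pos _).le
  rw [Real.exp_le_exp]
  have h3 : ((E ∩ T).card : ℝ) ≤ T.card := by
    exact_mod_cast Finset.card_le_card Finset.inter_subset_right
  have := exp_one_sub_one_le_two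
  have h4 : 0 ≤ Real.exp 1 - 1 := by linarith [Real.add_one_le_exp (1 : ℝ)]
  calc p * (Real.exp 1 - 1) * ((E ∩ T).card : ℝ) ≤ p * 2 * (T.card : ℝ) := by gcongr
    _ = _ := by ring

/-- Upper tail of the size of a random set. -/
lemma bernProb_card_ge_three_mul_le (h0 : 0 ≤ p) (h1 : p ≤ 1) {N : ℝ} (hN : (E.card : ℝ) ≤ N) :
    bernProb E p (fun s => 3 * (p * N) ≤ (s.card : ℝ)) ≤ Real.exp (-(p * N)) := by
  refine (bernProb_mono h0 h1 (R := fun s => 3 * (p * N) ≤ ((s ∩ E).card : ℝ))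
    fun s hs h => by rwa [Finset.inter_eq_left.2 hs]).trans
      ((bernProb_card_inter_ge_le h0 h1 E _).trans ?_)
  rw [Real.exp_le_exp]
  nlinarith

/-- Lower tail of the size of a random set. -/
lemma bernProb_card_le_le (h0 : 0 ≤ p) (h1 : p ≤ 1) {δ : ℝ} (hδ : 0 ≤ δ) (hδ1 : δ ≤ 1) :
    bernProb E p (fun s => (s.card : ℝ) ≤ (1 - δ) * (p * E.card)) ≤
      Real.exp (-(δ ^ 2 / 4 * (p * E.card))) := by
  set N : ℝ := p * E.card with hN
  have hN0 : 0 ≤ N := by positivity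
  -- Tilting by `-l` gives the exponent `(l ^ 2 - l * δ) * N`, which is smallest at `l = δ / 2`.
  set l : ℝ := δ / 2 with hl
  refine (bernProb_le_exp_mul h0 h1 (fun s => (-l) * ((s ∩ E).card : ℝ)) (-(l * ((1 - δ) * N)))
    fun s hs h => ?_).trans ?_
  · rw [Finset.inter_eq_left.2 hs]
    have : 0 ≤ l := by positivity
    nlinarith
  · refine (mul_le_mul_of_nonneg_left (bernExp_exp_mul_card_inter h0 h1 E (-l))
      (Real.exp_pos _).le).trans ?_
    rw [← Real.exp_add, Real.exp_le_exp, Finset.inter_self]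
    have h2 : Real.exp (-l) ≤ 1 - l + l ^ 2 := by
      have := Real.abs_exp_sub_one_sub_id_le (x := -l) (by
        rw [abs_neg, abs_of_nonneg (by positivity)]; linarith)
      have := (abs_le.1 this).2
      nlinarith
    have h3 : p * (Real.exp (-l) - 1) * (E.card : ℝ) = (Real.exp (-l) - 1) * N := by
      rw [hN]; ring
    rw [h3]
    have h4 : (Real.exp (-l) - 1) * N ≤ (-l + l ^ 2) * N :=
      mul_le_mul_of_nonneg_right (by linarith) hN0
    have h5 : l * ((1 - δ) * N) + (-l + l ^ 2) * N = -(δ ^ 2 / 4 * N) := by rw [hl]; ring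
    linarith

/-- Exponential moment bound for the number of elements of a random set that are related to an
earlier one: the compensator counts all elements related to an earlier element of the set. -/
lemma bernExp_exp_related_lt {ι : Type*} [LinearOrder ι] (h0 : 0 ≤ p) (h1 : p ≤ 1) (T : ι → Finset ι)
    (E : Finset ι) :
    bernExp E p (fun s => Real.exp
      ((({u ∈ s | ∃ v ∈ s, v < u ∧ u ∈ T v}).card : ℝ) -
        2 * p * (({u ∈ E | ∃ v ∈ s, v < u ∧ u ∈ T v}).card : ℝ))) ≤ 1 := by
  -- Expose elements in increasing order: whether the largest element `a` is related to an earlier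
  -- one is known before `a` is drawn, and drawing `a` affects no other element.
  induction E using Finset.induction_on_max with
  | empty => simp [bernExp]
  | insert a E ha ih =>
    have haE : a ∉ E := fun h => lt_irrefl _ (ha a h)
    rw [bernExp_insert haE, ← bernExp_const_mul, ← bernExp_const_mul, ← bernExp_add]
    refine (bernExp_mono h0 h1 fun s hs => ?_).trans ih
    have has : a ∉ s := fun h => haE (hs h)
    have hlt : ∀ v ∈ s, v < a := fun v hv => ha v (hs hv)
    have e1 : ∀ B : Finset ι, B ⊆ E → {u ∈ B | ∃ v ∈ insert a s, v < u ∧ u ∈ T v} =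
        {u ∈ B | ∃ v ∈ s, v < u ∧ u ∈ T v} := fun B hB => by
      refine Finset.filter_congr fun u hu => ?_
      simp only [Finset.mem_insert, exists_eq_or_imp]
      constructor
      · rintro (h | h)
        · exact absurd h.1 (ha u (hB hu)).not_gt
        · exact h
      · exact Or.inr
    have e2 : (∃ v ∈ insert a s, v < a ∧ a ∈ T v) ↔ ∃ v ∈ s, v < a ∧ a ∈ T v := by simp
    have e3 : a ∉ {u ∈ E | ∃ v ∈ s, v < u ∧ u ∈ T v} := fun h => haE (Finset.mem_filter.1 h).1
    have e4 : a ∉ {u ∈ s | ∃ v ∈ s, v < u ∧ u ∈ T v} := fun h => has (Finset.mem_filter.1 h).1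
    set x := ({u ∈ s | ∃ v ∈ s, v < u ∧ u ∈ T v}).card
    set y := ({u ∈ E | ∃ v ∈ s, v < u ∧ u ∈ T v}).card
    by_cases hR : ∃ v ∈ s, v < a ∧ a ∈ T v
    · rw [Finset.filter_insert, if_pos hR, Finset.filter_insert, if_pos (e2.2 hR),
        Finset.filter_insert, if_pos (e2.2 hR), e1 s hs, e1 E subset_rfl,
        Finset.card_insert_of_notMem e3, Finset.card_insert_of_notMem e4]
      push_cast
      have a1 : Real.exp ((x : ℝ) - 2 * p * (y + 1)) =
          Real.exp ((x : ℝ) - 2 * p * y) * Real.exp (-(2 * p)) := by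
        rw [← Real.exp_add]; ring_nf
      have a2 : Real.exp ((x : ℝ) + 1 - 2 * p * (y + 1)) =
          Real.exp ((x : ℝ) - 2 * p * y) * (Real.exp (-(2 * p)) * Real.exp 1) := by
        rw [← Real.exp_add, ← Real.exp_add]; ring_nf
      rw [a1, a2]
      -- Drawing a related `a` multiplies the expectation by `1 - p + p * e`, and the compensator by
      -- `exp (-2p)`; this is where the factor 2 is needed.
      have b1 : (1 - p + p * Real.exp 1) ≤ Real.exp (2 * p) := by
        nlinarith [Real.add_one_le_exp (2 * p), exp_one_sub_one_le_two]
      have b2 : Real.exp (-(2 * p)) * (1 - p + p * Real.exp 1) ≤ 1 := by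
        rw [Real.exp_neg, inv_mul_le_iff₀ (Real.exp_pos _), mul_one]; exact b1
      calc _ = Real.exp ((x : ℝ) - 2 * p * y) *
            (Real.exp (-(2 * p)) * (1 - p + p * Real.exp 1)) := by ring
        _ ≤ Real.exp ((x : ℝ) - 2 * p * y) * 1 := by gcongr
        _ = _ := mul_one _
    · rw [Finset.filter_insert, if_neg hR, Finset.filter_insert, if_neg (fun h => hR (e2.1 h)),
        Finset.filter_insert, if_neg (fun h => hR (e2.1 h)), e1 s hs, e1 E subset_rfl]
      linarith

/-- When `s` has at most `M` elements, the related elements lie in a union of at most `M` sets `T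
v`, which caps the compensator at `2 * p * (Δ * M)`. -/
lemma bernProb_related_lt_le {ι : Type*} [LinearOrder ι] (h0 : 0 ≤ p) (h1 : p ≤ 1)
    (T : ι → Finset ι)
    {E : Finset ι} {Δ M t : ℝ} (hΔ : 0 ≤ Δ) (hT : ∀ v, ((T v).card : ℝ) ≤ Δ) :
    bernProb E p (fun s => (s.card : ℝ) ≤ M ∧
      t ≤ (({u ∈ s | ∃ v ∈ s, v < u ∧ u ∈ T v}).card : ℝ)) ≤ Real.exp (-t + 2 * p * (Δ * M)) := by
  refine (bernProb_le_exp_mul h0 h1 (fun s => (({u ∈ s | ∃ v ∈ s, v < u ∧ u ∈ T v}).card : ℝ) -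
        2 * p * (({u ∈ E | ∃ v ∈ s, v < u ∧ u ∈ T v}).card : ℝ)) (t - 2 * p * (Δ * M))
        fun s hs h => ?_).trans ?_
  · have : (({u ∈ E | ∃ v ∈ s, v < u ∧ u ∈ T v}).card : ℝ) ≤ Δ * M := by
      calc (({u ∈ E | ∃ v ∈ s, v < u ∧ u ∈ T v}).card : ℝ)
          ≤ ((s.biUnion T).card : ℝ) := by
            refine Nat.cast_le.2 (Finset.card_le_card fun u hu => ?_)
            obtain ⟨hu, v, hv, -, hvu⟩ := Finset.mem_filter.1 hu
            exact Finset.mem_biUnion.2 ⟨v, hv, hvu⟩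
        _ ≤ ∑ v ∈ s, ((T v).card : ℝ) := by exact_mod_cast Finset.card_biUnion_le
        _ ≤ ∑ v ∈ s, Δ := Finset.sum_le_sum fun v _ => hT v
        _ = Δ * s.card := by rw [Finset.sum_const, nsmul_eq_mul, mul_comm]
        _ ≤ Δ * M := by gcongr; exact h.1
    have := mul_le_mul_of_nonneg_left this (by positivity : (0 : ℝ) ≤ 2 * p)
    linarith [h.2]
  · refine (mul_le_mul_of_nonneg_left (bernExp_exp_related_lt h0 h1 T E)
      (Real.exp_pos _).le).trans_eq ?_
    rw [mul_one]; ring_nf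

/-- In a random set, few elements are related to another element of the set, if the relation has
small degree. -/
lemma bernProb_related_le {ι : Type*} [LinearOrder ι] (h0 : 0 ≤ p) (h1 : p ≤ 1) (T : ι → Finset ι)
    {E : Finset ι} {Δ M t : ℝ} (hΔ : 0 ≤ Δ) (hT : ∀ v, ((T v).card : ℝ) ≤ Δ) :
    bernProb E p (fun s => (s.card : ℝ) ≤ M ∧
      2 * t ≤ (({u ∈ s | ∃ v ∈ s, v ≠ u ∧ u ∈ T v}).card : ℝ)) ≤
        2 * Real.exp (-t + 2 * p * (Δ * M)) := by
  -- A partner is either earlier or later, so one of the two one-sided counts reaches `t`. The later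
  -- partners are handled by reversing the order.
  have key : ∀ s ⊆ E, ((s.card : ℝ) ≤ M ∧
      2 * t ≤ (({u ∈ s | ∃ v ∈ s, v ≠ u ∧ u ∈ T v}).card : ℝ)) →
      (((s.card : ℝ) ≤ M ∧ t ≤ (({u ∈ s | ∃ v ∈ s, v < u ∧ u ∈ T v}).card : ℝ)) ∨
       ((s.card : ℝ) ≤ M ∧ t ≤ (({u ∈ s | ∃ v ∈ s, u < v ∧ u ∈ T v}).card : ℝ))) := by
    rintro s - ⟨hM, ht⟩
    by_contra! hcon
    obtain ⟨c1, c2⟩ := hcon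
    have hle : ({u ∈ s | ∃ v ∈ s, v ≠ u ∧ u ∈ T v}).card ≤
        ({u ∈ s | ∃ v ∈ s, v < u ∧ u ∈ T v}).card + ({u ∈ s | ∃ v ∈ s, u < v ∧ u ∈ T v}).card := by
      refine (Finset.card_le_card fun u hu => ?_).trans (Finset.card_union_le _ _)
      obtain ⟨hu, v, hv, hne, hvu⟩ := Finset.mem_filter.1 hu
      rcases lt_or_gt_of_ne hne with h | h
      · exact Finset.mem_union_left _ (Finset.mem_filter.2 ⟨hu, v, hv, h, hvu⟩)
      · exact Finset.mem_union_right _ (Finset.mem_filter.2 ⟨hu, v, hv, h, hvu⟩)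
    have hle' : ((({u ∈ s | ∃ v ∈ s, v ≠ u ∧ u ∈ T v}).card : ℕ) : ℝ) ≤ _ := Nat.cast_le.2 hle
    push_cast at hle'
    linarith [c1 hM, c2 hM]
  refine (bernProb_mono h0 h1 key).trans ((bernProb_or_le h0 h1).trans ?_)
  have a1 := bernProb_related_lt_le (E := E) (M := M) (t := t) h0 h1 T hΔ hT
  have a2 := bernProb_related_lt_le (ι := ιᵒᵈ) (E := E) (M := M) (t := t) h0 h1 T hΔ hT
  have a3 : bernProb E p (fun s => (s.card : ℝ) ≤ M ∧
      t ≤ (({u ∈ s | ∃ v ∈ s, u < v ∧ u ∈ T v}).card : ℝ)) ≤ Real.exp (-t + 2 * p * (Δ * M)) := a2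
  linarith

end RandomSubset

/-! ### The binomial random graph as a random edge set, and independence of stars. -/

section RandomGraph

set_option linter.unusedSectionVars false

open scoped Classical
open MeasureTheory

variable {V : Type*} [Fintype V] [DecidableEq V]

/-- The probability that the binomial random graph on `V` lies in `S`. -/
noncomputable def graphProb (p : unitInterval) (S : Set (SimpleGraph V)) : ℝ :=
  (SimpleGraph.binomialRandom V p).real S

lemma graphProb_mono {p : unitInterval} {S T : Set (SimpleGraph V)} (h : S ⊆ T) :
    graphProb p S ≤ graphProb p T := measureReal_mono h

lemma graphProb_union_le {p : unitInterval} (S T : Set (SimpleGraph V)) :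
    graphProb p (S ∪ T) ≤ graphProb p S + graphProb p T := measureReal_union_le S T

lemma graphProb_exists_le {p : unitInterval} {ι : Type*} (I : Finset ι)
    (S : ι → SimpleGraph V → Prop) :
    graphProb p {Γ | ∃ i ∈ I, S i Γ} ≤ ∑ i ∈ I, graphProb p {Γ | S i Γ} := by
  have h : {Γ | ∃ i ∈ I, S i Γ} = ⋃ i ∈ I, {Γ | S i Γ} := by ext; simp
  rw [h]
  exact measureReal_biUnion_finset_le I _

lemma graphProb_exists_le_of_le {p : unitInterval} {ι : Type*} (I : Finset ι)
    (S : ι → SimpleGraph V → Prop) {δ : ℝ} (h : ∀ i ∈ I, graphProb p {Γ | S i Γ} ≤ δ) :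
    graphProb p {Γ | ∃ i ∈ I, S i Γ} ≤ I.card * δ := by
  refine (graphProb_exists_le I S).trans ((Finset.sum_le_sum h).trans_eq ?_)
  rw [Finset.sum_const, nsmul_eq_mul]

lemma measurableSingletonClass_simpleGraph : MeasurableSingletonClass (SimpleGraph V) where
  measurableSet_singleton G := by
    have h : {G} = SimpleGraph.edgeSet ⁻¹' {G.edgeSet} := by ext; simp
    rw [h]
    exact SimpleGraph.measurable_edgeSet (MeasurableSet.singleton _)

lemma graphProb_eq_sum (p : unitInterval) (S : Set (SimpleGraph V)) : graphProb p S =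
    ∑ Γ : SimpleGraph V, if Γ ∈ S then (SimpleGraph.binomialRandom V p).real {Γ} else 0 := by
  have := measurableSingletonClass_simpleGraph (V := V)
  rw [← Finset.sum_filter, sum_measureReal_singleton]
  unfold graphProb
  congr 1
  ext; simp

/-- Markov's inequality for the number of events that occur. -/
lemma graphProb_card_ge_le {p : unitInterval} {ι : Type*} (I : Finset ι)
    (S : ι → SimpleGraph V → Prop) [∀ Γ, DecidablePred fun i => S i Γ] {t : ℝ} (ht : 0 < t) :
    graphProb p {Γ | t ≤ (({i ∈ I | S i Γ}).card : ℝ)} ≤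
      (∑ i ∈ I, graphProb p {Γ | S i Γ}) / t := by
  have hsum : ∀ A : Set (SimpleGraph V), graphProb p A =
      ∑ Γ : SimpleGraph V, (SimpleGraph.binomialRandom V p).real {Γ} * if Γ ∈ A then 1 else 0 := by
    intro A
    simp only [graphProb_eq_sum, mul_ite, mul_one, mul_zero]
  rw [le_div_iff₀ ht]
  simp only [hsum]
  rw [Finset.sum_comm, Finset.sum_mul]
  refine Finset.sum_le_sum fun Γ _ => ?_
  rw [← Finset.mul_sum, mul_assoc]
  refine mul_le_mul_of_nonneg_left ?_ measureReal_nonneg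
  refine le_trans (b := (({i ∈ I | S i Γ}).card : ℝ)) ?_ ?_
  swap
  · rw [Finset.card_filter]
    push_cast
    refine Finset.sum_le_sum fun i _ => ?_
    by_cases h : S i Γ <;> simp [h]
  split_ifs with h
  · simpa using h
  · simp

/-- The potential edges of a graph on `V`. -/
def allEdges (V : Type*) [Fintype V] [DecidableEq V] : Finset (Sym2 V) :=
  {e | ¬ e.IsDiag}

lemma edgeSet_fromEdgeSet_of_subset_allEdges {s : Finset (Sym2 V)} (hs : s ⊆ allEdges V) :
    (SimpleGraph.fromEdgeSet (s : Set (Sym2 V))).edgeSet = s := by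
  rw [SimpleGraph.edgeSet_fromEdgeSet]
  ext e
  simp only [Set.mem_sdiff, Finset.mem_coe]
  exact ⟨fun h => h.1, fun h => ⟨h, fun h' => (Finset.mem_filter.1 (hs h)).2 (by simpa using h')⟩⟩

/-- Transfers the tail bounds for random sets to the measure on graphs, by comparing the masses of
single graphs. -/
lemma graphProb_eq_bernProb (p : unitInterval) (S : Set (SimpleGraph V)) :
    graphProb p S = bernProb (allEdges V) p
      (fun s => SimpleGraph.fromEdgeSet (s : Set (Sym2 V)) ∈ S) := by
  have hcard : (allEdges V).card = (Nat.card V).choose 2 := by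
    rw [Nat.card_eq_fintype_card, ← Sym2.card_diagSet_compl]
    unfold allEdges
    rw [Fintype.card_subtype]
    congr 1
  rw [graphProb_eq_sum]
  unfold bernProb bernExp
  symm
  refine Finset.sum_bij (fun s _ => SimpleGraph.fromEdgeSet (s : Set (Sym2 V)))
    (fun _ _ => Finset.mem_univ _) ?_ ?_ ?_
  · intro s hs t ht hst
    have := congrArg SimpleGraph.edgeSet hst
    rw [edgeSet_fromEdgeSet_of_subset_allEdges (Finset.mem_powerset.1 hs),
      edgeSet_fromEdgeSet_of_subset_allEdges (Finset.mem_powerset.1 ht)] at this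
    exact_mod_cast this
  · intro Γ _
    refine ⟨Γ.edgeFinset, ?_, ?_⟩
    · rw [Finset.mem_powerset]
      intro e he
      simp only [allEdges, Finset.mem_filter, Finset.mem_univ, true_and]
      exact Γ.not_isDiag_of_mem_edgeFinset he
    · simp
  · intro s hs
    have hs' := Finset.mem_powerset.1 hs
    by_cases hS : SimpleGraph.fromEdgeSet (s : Set (Sym2 V)) ∈ S
    · rw [if_pos hS]
      beta_reduce
      rw [if_pos hS, mul_one, measureReal_def, SimpleGraph.binomialRandom_singleton,
        edgeSet_fromEdgeSet_of_subset_allEdges hs', Set.ncard_coe_finset, Finset.card_sdiff_of_subset hs', hcard]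
      simp
    · rw [if_neg hS]
      beta_reduce
      rw [if_neg hS, mul_zero]

lemma graphProb_edges_subset_le (p : unitInterval) {B : Finset (Sym2 V)} (hB : B ⊆ allEdges V) :
    graphProb p {Γ | ∀ e ∈ B, e ∈ Γ.edgeSet} ≤ (p : ℝ) ^ B.card := by
  rw [graphProb_eq_bernProb]
  have h := bernExp_prod (E := allEdges V) (p := p) (fun _ => 1)
    (fun e => if e ∈ B then 0 else 1)
  have h2 : ∏ i ∈ allEdges V, ((p : ℝ) * 1 + (1 - p) * if i ∈ B then 0 else 1) = (p : ℝ) ^ B.card := by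
    rw [← Finset.prod_subset hB]
    · rw [← Finset.prod_const]
      exact Finset.prod_congr rfl fun i hi => by simp [hi]
    · intro i _ hi; simp [hi]
  rw [← h2, ← h]
  refine bernExp_mono p.2.1 p.2.2 fun s hs => ?_
  split_ifs with hc
  · rw [Finset.prod_const_one, one_mul, Finset.prod_eq_one]
    intro e he
    rw [if_neg]
    intro heB
    have := hc e heB
    rw [edgeSet_fromEdgeSet_of_subset_allEdges hs] at this
    exact (Finset.mem_sdiff.1 he).2 (by simpa using this)
  · refine mul_nonneg (by simp) (Finset.prod_nonneg fun i _ => ?_)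
    split_ifs <;> norm_num

lemma graphProb_edges_disjoint_le (p : unitInterval) {B : Finset (Sym2 V)} (hB : B ⊆ allEdges V) :
    graphProb p {Γ | ∀ e ∈ B, e ∉ Γ.edgeSet} ≤ (1 - (p : ℝ)) ^ B.card := by
  rw [graphProb_eq_bernProb]
  have h := bernExp_prod_mem (E := allEdges V) (p := p) (fun e => if e ∈ B then 0 else 1)
  have h2 : ∏ i ∈ allEdges V, ((p : ℝ) * (if i ∈ B then 0 else 1) + (1 - p)) =
      (1 - (p : ℝ)) ^ B.card := by
    rw [← Finset.prod_subset hB]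
    · rw [← Finset.prod_const]
      exact Finset.prod_congr rfl fun i hi => by simp [hi]
    · intro i _ hi; simp [hi]
  rw [← h2, ← h]
  refine bernExp_mono p.2.1 p.2.2 fun s hs => ?_
  split_ifs with hc
  · rw [Finset.prod_eq_one]
    intro e he
    rw [if_neg]
    intro heB
    have := hc e heB
    rw [edgeSet_fromEdgeSet_of_subset_allEdges hs] at this
    exact this he
  · refine Finset.prod_nonneg fun i _ => ?_
    split_ifs <;> norm_num

/-- The neighbours of `a` in `A`. -/
noncomputable def nbrIn (Γ : SimpleGraph V) (A : Finset V) (a : V) : Finset V := {b ∈ A | Γ.Adj a b}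

/-- The graph `Γ` without the edges between `a` and `A`. -/
def cutStar (Γ : SimpleGraph V) (A : Finset V) (a : V) : SimpleGraph V :=
  Γ.deleteEdges {e | ∃ b ∈ A, e = s(a, b)}

@[simp] lemma mem_nbrIn {Γ : SimpleGraph V} {A : Finset V} {a b : V} :
    b ∈ nbrIn Γ A a ↔ b ∈ A ∧ Γ.Adj a b := by simp [nbrIn]

lemma cutStar_le (Γ : SimpleGraph V) (A : Finset V) (a : V) : cutStar Γ A a ≤ Γ :=
  SimpleGraph.deleteEdges_le _

lemma cutStar_adj_of_ne {Γ : SimpleGraph V} {A : Finset V} {a b c : V} (h : Γ.Adj b c)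
    (hb : b ≠ a) (hc : c ≠ a) : (cutStar Γ A a).Adj b c := by
  rw [cutStar, SimpleGraph.deleteEdges_adj]
  refine ⟨h, ?_⟩
  rintro ⟨d, -, hd⟩
  rcases Sym2.eq_iff.1 hd with h | h
  · exact hb h.1
  · exact hc h.2

lemma cutStar_adj_of_notMem {Γ : SimpleGraph V} {A : Finset V} {a b c : V} (h : Γ.Adj b c)
    (hb : b ∉ A) (hc : c ∉ A) : (cutStar Γ A a).Adj b c := by
  rw [cutStar, SimpleGraph.deleteEdges_adj]
  refine ⟨h, ?_⟩
  rintro ⟨d, hd, hd'⟩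
  rcases Sym2.eq_iff.1 hd' with h | h
  · exact hc (h.2 ▸ hd)
  · exact hb (h.1 ▸ hd)

/-- The edges between `a` and `A` are independent of all the other edges. -/
lemma graphProb_cutStar_nbrIn_le (p : unitInterval) {A : Finset V} {a : V} (ha : a ∉ A)
    (Q : SimpleGraph V → Finset V → Prop) {δ : ℝ} (h : ∀ H, bernProb A p (Q H) ≤ δ) :
    graphProb p {Γ | Q (cutStar Γ A a) (nbrIn Γ A a)} ≤ δ := by
  let e : V ↪ Sym2 V := ⟨fun b => s(a, b), fun b c hbc => Sym2.congr_right.1 hbc⟩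
  have hsub : A.map e ⊆ allEdges V := by
    intro x hx
    obtain ⟨b, hb, rfl⟩ := Finset.mem_map.1 hx
    simp only [allEdges, Finset.mem_filter, Finset.mem_univ, true_and]
    change ¬ (s(a, b)).IsDiag
    rw [Sym2.mk_isDiag_iff]
    rintro rfl
    exact ha hb
  -- Split the potential edges into the star from `a` to `A` and the rest. Given the rest, the cut
  -- graph is fixed, while the neighbourhood of `a` in `A` is a `p`-random subset of `A`.
  rw [graphProb_eq_bernProb, ← Finset.sdiff_union_of_subset hsub]
  unfold bernProb
  rw [bernExp_union Finset.sdiff_disjoint]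
  have h1 : bernExp (allEdges V \ A.map e) (p : ℝ) (fun _ => δ) = δ := by
    have := bernExp_const_mul (E := allEdges V \ A.map e) (p := (p : ℝ)) (f := fun _ => 1) δ
    rwa [bernExp_one, mul_one] at this
  rw [← h1]
  refine bernExp_mono p.2.1 p.2.2 fun s hs => ?_
  rw [bernExp_map]
  refine le_trans (le_of_eq ?_) (h (SimpleGraph.fromEdgeSet (s : Set (Sym2 V))))
  refine bernExp_congr fun t ht => ?_
  have hs1 : ∀ b ∈ A, s(a, b) ∉ s := fun b hb hbs =>
    (Finset.mem_sdiff.1 (hs hbs)).2 (Finset.mem_map.2 ⟨b, hb, rfl⟩)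
  have e1 : cutStar (SimpleGraph.fromEdgeSet ((s ∪ t.map e : Finset (Sym2 V)) : Set (Sym2 V))) A a =
      SimpleGraph.fromEdgeSet (s : Set (Sym2 V)) := by
    ext b c
    rw [cutStar, SimpleGraph.deleteEdges_adj, SimpleGraph.fromEdgeSet_adj,
      SimpleGraph.fromEdgeSet_adj]
    simp only [Finset.coe_union, Set.mem_union, Finset.mem_coe]
    constructor
    · rintro ⟨⟨h1 | h1, h2⟩, h3⟩
      · exact ⟨h1, h2⟩
      · obtain ⟨d, hd, hd'⟩ := Finset.mem_map.1 h1
        exact absurd ⟨d, ht hd, hd'.symm⟩ h3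
    · rintro ⟨h1, h2⟩
      refine ⟨⟨Or.inl h1, h2⟩, ?_⟩
      rintro ⟨d, hd, hd'⟩
      exact hs1 d hd (hd' ▸ h1)
  have e2 : nbrIn (SimpleGraph.fromEdgeSet ((s ∪ t.map e : Finset (Sym2 V)) : Set (Sym2 V))) A a =
      t := by
    ext b
    rw [mem_nbrIn, SimpleGraph.fromEdgeSet_adj]
    simp only [Finset.coe_union, Set.mem_union, Finset.mem_coe]
    constructor
    · rintro ⟨hb, h1 | h1, -⟩
      · exact absurd h1 (hs1 b hb)
      · obtain ⟨d, hd, hd'⟩ := Finset.mem_map.1 h1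
        have : d = b := Sym2.congr_right.1 hd'
        exact this ▸ hd
    · intro hb
      refine ⟨ht hb, Or.inr (Finset.mem_map.2 ⟨b, hb, rfl⟩), ?_⟩
      rintro rfl
      exact ha (ht hb)
  simp only [Set.mem_ofPred_eq, e1, e2]

lemma graphProb_nbrIn_le (p : unitInterval) {A : Finset V} {a : V} (ha : a ∉ A)
    (Q : Finset V → Prop) {δ : ℝ} (h : bernProb A p Q ≤ δ) :
    graphProb p {Γ | Q (nbrIn Γ A a)} ≤ δ :=
  graphProb_cutStar_nbrIn_le p ha (fun _ => Q) fun _ => h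

end RandomGraph

/-! ### Cycles as periodic sequences. -/

section Cycles

variable {V : Type*} {G H : SimpleGraph V} {L : ℕ} {c : ℕ → V}

/-- `c` runs periodically around a cycle of length `L` in `G`. -/
def IsCyc (G : SimpleGraph V) (L : ℕ) (c : ℕ → V) : Prop :=
  (∀ i, G.Adj (c i) (c (i + 1))) ∧ ∀ i j, c i = c j ↔ i % L = j % L

lemma IsCyc.mono (h : IsCyc G L c) (hGH : G ≤ H) : IsCyc H L c :=
  ⟨fun i => hGH (h.1 i), h.2⟩

lemma IsCyc.shift (h : IsCyc G L c) (a : ℕ) : IsCyc G L (fun i => c (a + i)) := by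
  refine ⟨fun i => h.1 (a + i), fun i j => (h.2 _ _).trans ?_⟩
  exact ⟨fun h' => Nat.ModEq.add_left_cancel' a h', fun h' => Nat.ModEq.add_left a h'⟩

lemma IsCyc.apply_length (h : IsCyc G L c) : c L = c 0 := (h.2 L 0).2 (by simp)

lemma IsCyc.ne (h : IsCyc G L c) {i j : ℕ} (hij : i < j) (hj : j < i + L) : c i ≠ c j := by
  intro he
  have h1 : i ≡ j [MOD L] := (h.2 i j).1 he
  have h2 := (Nat.modEq_iff_dvd' hij.le).1 h1
  have := Nat.le_of_dvd (by omega) h2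
  omega

/-- By periodicity, any vertex of the cycle is met again after any given position, so searches along
the cycle may always run forward. -/
lemma IsCyc.exists_ge (hc : IsCyc G L c) (hL : 0 < L)
    (i j : ℕ) : ∃ l, i ≤ l ∧ c l = c j :=
  ⟨j + i * L, by nlinarith, (hc.2 _ _).2 (by simp)⟩

lemma exists_isCyc_of_isContained (hL : 3 ≤ L) (h : (SimpleGraph.cycleGraph L).IsContained G) :
    ∃ c, IsCyc G L c := by
  obtain ⟨f⟩ := h
  have hL0 : 0 < L := by omega
  refine ⟨fun i => f ⟨i % L, Nat.mod_lt _ hL0⟩, fun i => ?_, fun i j => ?_⟩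
  · refine f.toHom.map_adj ?_
    rw [SimpleGraph.cycleGraph_adj']
    right
    rw [Fin.sub_def]
    have h1 : i % L < L := Nat.mod_lt _ hL0
    simp only
    rcases Nat.lt_or_ge (i % L + 1) L with h2 | h2
    · have h3 : (i + 1) % L = i % L + 1 := by
        rw [Nat.add_mod, Nat.mod_eq_of_lt (show 1 < L by omega), Nat.mod_eq_of_lt h2]
      rw [h3, show L - i % L + (i % L + 1) = 1 + L by omega, Nat.add_mod_right,
        Nat.mod_eq_of_lt (by omega)]
    · have h3 : (i + 1) % L = 0 := by
        rw [Nat.add_mod, Nat.mod_eq_of_lt (show 1 < L by omega), show i % L + 1 = L by omega,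
          Nat.mod_self]
      rw [h3, show L - i % L + 0 = 1 by omega, Nat.mod_eq_of_lt (by omega)]
  · have : Function.Injective f := f.injective
    rw [this.eq_iff, Fin.mk.injEq]

end Cycles

/-! ### Sizes of sets reachable by walks. -/

section Reach

open scoped Classical

variable {V : Type*} [Fintype V] [DecidableEq V]

/-- The set of all `b` with `r a b` for some `a ∈ S`. -/
noncomputable def nbSet (r : V → V → Prop) (S : Finset V) : Finset V :=
  S.biUnion fun a => {b | r a b}

lemma mem_nbSet_of_rel {r : V → V → Prop} {S : Finset V} {a b : V} (ha : a ∈ S) (h : r a b) :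
    b ∈ nbSet r S := Finset.mem_biUnion.2 ⟨a, ha, by simpa using h⟩

/-- Turns a segment of a cycle into membership in an iterated neighbourhood, whose size is
controlled by degrees. -/
lemma mem_iterate_nbSet {r : V → V → Prop} {S : Finset V} (d : ℕ → V) {s : ℕ} (hs : d s ∈ S)
    (i : ℕ) (h : ∀ j, s ≤ j → j < s + i → r (d j) (d (j + 1))) :
    d (s + i) ∈ (nbSet r)^[i] S := by
  induction i with
  | zero => simpa using hs
  | succ i ih =>
    rw [Function.iterate_succ_apply', ← add_assoc]
    exact mem_nbSet_of_rel (ih fun j h1 h2 => h j h1 (by omega)) (h (s + i) (by omega) (by omega))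

lemma card_nbSet_le {r : V → V → Prop} {M : ℝ} (hr : ∀ a, (({b | r a b} : Finset V).card : ℝ) ≤ M)
    {S : Finset V} {N : ℝ} (hM : 0 ≤ M) (hN : (S.card : ℝ) ≤ N) :
    ((nbSet r S).card : ℝ) ≤ N * M := by
  calc ((nbSet r S).card : ℝ) ≤ ∑ a ∈ S, (({b | r a b} : Finset V).card : ℝ) := by
        exact_mod_cast Finset.card_biUnion_le
    _ ≤ ∑ a ∈ S, M := Finset.sum_le_sum fun a _ => hr a
    _ = S.card * M := by rw [Finset.sum_const, nsmul_eq_mul]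
    _ ≤ N * M := by gcongr

lemma card_iterate_nbSet_le {r : V → V → Prop} {M : ℝ}
    (hr : ∀ a, (({b | r a b} : Finset V).card : ℝ) ≤ M) (hM : 0 ≤ M)
    {S : Finset V} {N : ℝ} (hN : (S.card : ℝ) ≤ N) (i : ℕ) :
    ((((nbSet r)^[i] S).card : ℕ) : ℝ) ≤ N * M ^ i := by
  induction i with
  | zero => simpa using hN
  | succ i ih =>
    rw [Function.iterate_succ_apply', pow_succ, ← mul_assoc]
    exact card_nbSet_le hr hM ih

end Reach

/-! ### The construction, and why it is free of `(2k+1)`-cycles but hard to colour. -/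

section Construction

set_option linter.unusedSectionVars false

open scoped Classical

variable {V : Type*} [Fintype V] [DecidableEq V]

/-- A partition of the vertices into a small part `X` and two large parts `U` and `W`, together
with the parameters of the construction: the cycle length `2 * k + 1` and bounds `D`, `D'` for the
degrees from `X` to `X` and from `U` to `X`. -/
structure Layout (V : Type*) where
  X : Finset V
  U : Finset V
  W : Finset V
  notMem_U_of_X : ∀ v ∈ X, v ∉ U
  notMem_W_of_X : ∀ v ∈ X, v ∉ W
  notMem_W_of_U : ∀ v ∈ U, v ∉ W
  cover : ∀ v, v ∈ X ∨ v ∈ U ∨ v ∈ W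
  k : ℕ
  two_le_k : 2 ≤ k
  D : ℕ
  D' : ℕ

namespace Layout

variable (P : Layout V) (Γ : SimpleGraph V)

/-- The vertices of `X` of degree at most `D` in `X` that lie on no cycle of length `2 * k + 1`
inside `X`. -/
noncomputable def coreSet : Finset V :=
  {x ∈ P.X | (nbrIn Γ P.X x).card ≤ P.D ∧
    ¬ ∃ c, IsCyc Γ (2 * P.k + 1) c ∧ (∀ i, c i ∈ P.X) ∧ c 0 = x}

/-- The graph induced on the core vertices. -/
def core : SimpleGraph V where
  Adj a b := Γ.Adj a b ∧ a ∈ P.coreSet Γ ∧ b ∈ P.coreSet Γ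
  symm := ⟨fun _ _ h => ⟨h.1.symm, h.2.2, h.2.1⟩⟩
  loopless := ⟨fun _ h => h.1.ne rfl⟩

/-- The pairs that are kept between `U` and the other parts. -/
def Link (a b : V) : Prop := a ∈ P.U ∧ (b ∈ P.W ∨ b ∈ P.X ∧ (nbrIn Γ P.X a).card ≤ P.D')

/-- The core, together with all edges between `U` and `W`, and the edges between `X` and the
vertices of `U` that have few neighbours in `X`. -/
def base : SimpleGraph V where
  Adj a b := (P.core Γ).Adj a b ∨ Γ.Adj a b ∧ (P.Link Γ a b ∨ P.Link Γ b a)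
  symm := ⟨fun _ _ h => h.imp (fun h => h.symm) fun h => ⟨h.1.symm, h.2.symm⟩⟩
  loopless := ⟨fun _ h => h.elim (fun h => h.ne rfl) fun h => h.1.ne rfl⟩

/-- The edge from `w ∈ W` to `u ∈ U` lies on a cycle of the base graph that proceeds to `X`. -/
def CutW (w u : V) : Prop :=
  w ∈ P.W ∧ u ∈ P.U ∧ ∃ c, IsCyc (P.base Γ) (2 * P.k + 1) c ∧ c 0 = w ∧ c 1 = u ∧ c 2 ∈ P.X

/-- The edge from `x ∈ X` to `u ∈ U` lies on a cycle of the base graph that avoids `W` and comes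
from `X`. -/
def CutX (x u : V) : Prop :=
  x ∈ P.X ∧ u ∈ P.U ∧ ∃ c, IsCyc (P.base Γ) (2 * P.k + 1) c ∧ c 0 ∈ P.X ∧ c 1 = x ∧ c 2 = u ∧
    ∀ i, c i ∉ P.W

/-- The base graph without the edges that are cut. -/
def final : SimpleGraph V where
  Adj a b := (P.base Γ).Adj a b ∧ ¬ (P.CutW Γ a b ∨ P.CutX Γ a b) ∧
    ¬ (P.CutW Γ b a ∨ P.CutX Γ b a)
  symm := ⟨fun _ _ h => ⟨h.1.symm, h.2.2, h.2.1⟩⟩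
  loopless := ⟨fun _ h => h.1.ne rfl⟩

variable {P Γ}

lemma mem_X_of_mem_coreSet {a : V} (h : a ∈ P.coreSet Γ) : a ∈ P.X := (Finset.mem_filter.1 h).1

lemma final_le_base : P.final Γ ≤ P.base Γ := fun _ _ h => h.1

lemma base_le : P.base Γ ≤ Γ := fun _ _ h => h.elim (fun h => h.1) fun h => h.1

lemma core_adj_of_base_adj {a b : V} (h : (P.base Γ).Adj a b) (ha : a ∈ P.X) (hb : b ∈ P.X) :
    (P.core Γ).Adj a b := by
  rcases h with h | ⟨-, h | h⟩
  · exact h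
  · exact absurd h.1 (P.notMem_U_of_X a ha)
  · exact absurd h.1 (P.notMem_U_of_X b hb)

lemma notMem_U_of_base_adj {a b : V} (h : (P.base Γ).Adj a b) (ha : a ∈ P.U) : b ∉ P.U := by
  intro hb
  rcases h with h | ⟨-, h | h⟩
  · exact P.notMem_U_of_X a (mem_X_of_mem_coreSet h.2.1) ha
  · rcases h.2 with h | h
    · exact P.notMem_W_of_U b hb h
    · exact P.notMem_U_of_X b h.1 hb
  · rcases h.2 with h | h
    · exact P.notMem_W_of_U a ha h
    · exact P.notMem_U_of_X a h.1 ha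

lemma mem_U_of_base_adj_W {a b : V} (h : (P.base Γ).Adj a b) (ha : a ∈ P.W) : b ∈ P.U := by
  rcases h with h | ⟨-, h | h⟩
  · exact absurd ha (P.notMem_W_of_X a (mem_X_of_mem_coreSet h.2.1))
  · exact absurd ha (P.notMem_W_of_U a h.1)
  · exact h.1

lemma mem_X_of_base_adj {a b : V} (h : (P.base Γ).Adj a b) (ha : a ∉ P.U) (hb : b ∉ P.U) :
    a ∈ P.X ∧ b ∈ P.X := by
  rcases h with h | ⟨-, h | h⟩
  · exact ⟨mem_X_of_mem_coreSet h.2.1, mem_X_of_mem_coreSet h.2.2⟩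
  · exact absurd h.1 ha
  · exact absurd h.1 hb

lemma card_nbrIn_le_of_base_adj {a b : V} (h : (P.base Γ).Adj a b) (ha : a ∈ P.U) (hb : b ∈ P.X) :
    (nbrIn Γ P.X a).card ≤ P.D' := by
  rcases h with h | ⟨-, h | h⟩
  · exact absurd ha (P.notMem_U_of_X a (mem_X_of_mem_coreSet h.2.1))
  · rcases h.2 with h | h
    · exact absurd h (P.notMem_W_of_X b hb)
    · exact h.2
  · exact absurd h.1 (P.notMem_U_of_X b hb)

/-- No base edge lies inside `U`, and a base edge that avoids `U` lies inside `X`. Without such an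
edge, membership in `U` would alternate around a cycle of odd length. -/
lemma exists_two_mem_X {c : ℕ → V} (hc : IsCyc (P.base Γ) (2 * P.k + 1) c) :
    ∃ i, c i ∈ P.X ∧ c (i + 1) ∈ P.X := by
  by_contra! hcon
  have halt : ∀ i, c (i + 1) ∈ P.U ↔ c i ∉ P.U := by
    intro i
    constructor
    · exact fun h h' => notMem_U_of_base_adj (hc.1 i) h' h
    · intro h
      by_contra h'
      have := mem_X_of_base_adj (hc.1 i) h h'
      exact hcon i this.1 this.2
  have heven : ∀ i, c (2 * i) ∈ P.U ↔ c 0 ∈ P.U := by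
    intro i
    induction i with
    | zero => simp
    | succ i ih => rw [show 2 * (i + 1) = 2 * i + 1 + 1 by ring, halt, halt, not_not, ih]
  have h1 := halt (2 * P.k)
  rw [hc.apply_length, heven] at h1
  tauto

/-- A cyclic sequence that meets `W` and `X` contains a step from `W` through `U` to `X`. -/
lemma exists_W_U_X {c : ℕ → V} (hc : ∀ i, (P.base Γ).Adj (c i) (c (i + 1))) {i j : ℕ}
    (hi : c i ∈ P.W) (hij : i ≤ j) (hj : c j ∈ P.X) :
    ∃ l, c l ∈ P.W ∧ c (l + 1) ∈ P.U ∧ c (l + 2) ∈ P.X := by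
  induction j using Nat.strong_induction_on with
  | _ j ih =>
    have h1 : i ≠ j := fun h => P.notMem_W_of_X _ hj (h ▸ hi)
    obtain ⟨j, rfl⟩ : ∃ l, j = l + 1 := ⟨j - 1, by omega⟩
    -- Walk backwards from `j`: a vertex of `X` is never preceded by `W`, and a vertex of `U` is
    -- preceded by `X` or `W`.
    rcases P.cover (c j) with h | h | h
    · exact ih j (by omega) (by omega) h
    · have h2 : i ≠ j := fun h' => P.notMem_W_of_U _ h (h' ▸ hi)
      obtain ⟨j, rfl⟩ : ∃ l, j = l + 1 := ⟨j - 1, by omega⟩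
      rcases P.cover (c j) with h' | h' | h'
      · exact ih j (by omega) (by omega) h'
      · exact absurd h (notMem_U_of_base_adj (hc j) h')
      · exact ⟨j, h', h, hj⟩
    · exact absurd (mem_U_of_base_adj_W (hc j) h) (P.notMem_U_of_X _ hj)

/-- A sequence that avoids `W` and reaches `U` after a step inside `X` contains two vertices of `X`
followed by a vertex of `U`. -/
lemma exists_X_X_U {c : ℕ → V} (hW : ∀ i, c i ∉ P.W) {i j : ℕ} (hi : c i ∈ P.X)
    (hi' : c (i + 1) ∈ P.X) (hij : i ≤ j) (hj : c j ∈ P.U) :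
    ∃ l, c l ∈ P.X ∧ c (l + 1) ∈ P.X ∧ c (l + 2) ∈ P.U := by
  by_contra! hcon
  have hall : ∀ l, c (i + l) ∈ P.X ∧ c (i + l + 1) ∈ P.X := by
    intro l
    induction l with
    | zero => exact ⟨hi, hi'⟩
    | succ l ih =>
      refine ⟨ih.2, ?_⟩
      have := hcon (i + l) ih.1 ih.2
      rcases P.cover (c (i + l + 2)) with h | h | h
      · exact h
      · exact absurd h this
      · exact absurd h (hW _)
  have := (hall (j - i)).1
  rw [Nat.add_sub_cancel' hij] at this
  exact P.notMem_U_of_X _ this hj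

/-- The final graph contains no cycle of length `2 * k + 1`. -/
lemma cycleGraph_free_final : (SimpleGraph.cycleGraph (2 * P.k + 1)).Free (P.final Γ) := by
  intro hcon
  have hk := P.two_le_k
  obtain ⟨c, hc⟩ := exists_isCyc_of_isContained (by omega) hcon
  have hb := hc.mono final_le_base
  obtain ⟨i, hi, hi'⟩ := exists_two_mem_X hb
  -- A cycle meeting `W` uses an edge in `CutW`; one meeting `U` but not `W` uses an edge in `CutX`;
  -- one inside `X` contradicts the choice of the core.
  by_cases hW : ∃ j, c j ∈ P.W
  · obtain ⟨j, hj⟩ := hW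
    obtain ⟨l, hl, hl'⟩ := hc.exists_ge (by omega) j i
    obtain ⟨q, hq, hq1, hq2⟩ := exists_W_U_X hb.1 hj hl (hl' ▸ hi)
    exact (hc.1 q).2.1 (Or.inl ⟨hq, hq1, _, hb.shift q, rfl, rfl, hq2⟩)
  · push Not at hW
    by_cases hU : ∃ j, c j ∈ P.U
    · obtain ⟨j, hj⟩ := hU
      obtain ⟨l, hl, hl'⟩ := hc.exists_ge (by omega) i j
      obtain ⟨q, hq, hq1, hq2⟩ := exists_X_X_U hW hi hi' hl (hl' ▸ hj)
      exact (hc.1 (q + 1)).2.1 (Or.inr ⟨hq1, hq2, _, hb.shift q, hq, rfl, rfl, fun i => hW _⟩)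
    · push Not at hU
      have hX : ∀ i, c i ∈ P.X := fun i => by
        rcases P.cover (c i) with h | h | h
        · exact h
        · exact absurd h (hU i)
        · exact absurd h (hW i)
      have h1 := core_adj_of_base_adj (hb.1 0) (hX 0) (hX 1)
      exact (Finset.mem_filter.1 h1.2.1).2.2 ⟨c, hb.mono base_le, hX, rfl⟩

/-- Every cut edge has an end in `U`, so the core, which forces the chromatic number up, is
untouched. -/
lemma core_le_final : P.core Γ ≤ P.final Γ := by
  intro a b h
  have ha := P.notMem_U_of_X a (mem_X_of_mem_coreSet h.2.1)
  have hb := P.notMem_U_of_X b (mem_X_of_mem_coreSet h.2.2)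
  refine ⟨Or.inl h, ?_, ?_⟩
  · rintro (h | h)
    · exact hb h.2.1
    · exact hb h.2.1
  · rintro (h | h)
    · exact ha h.2.1
    · exact ha h.2.1

/-- If no large subset of `X` is independent, the final graph has large chromatic number. -/
lemma lt_chromaticNumber_final {C s : ℕ}
    (hs : ∀ S ⊆ P.X, S.card = s → ∃ a ∈ S, ∃ b ∈ S, Γ.Adj a b)
    (hcard : C * s < (P.coreSet Γ).card) :
    ¬ (P.final Γ).chromaticNumber ≤ (C : ℕ∞) := by
  intro hcol
  obtain ⟨f⟩ := SimpleGraph.chromaticNumber_le_iff_colorable.1 hcol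
  obtain ⟨y, -, hy⟩ := Finset.exists_lt_card_fiber_of_mul_lt_card_of_maps_to
    (s := P.coreSet Γ) (t := Finset.univ) (f := f) (n := s) (fun _ _ => Finset.mem_univ _)
    (by simpa using hcard)
  obtain ⟨S, hS, hS'⟩ := Finset.exists_subset_card_eq hy.le
  have hmem : ∀ a ∈ S, a ∈ P.coreSet Γ ∧ f a = y := fun a ha => by simpa using hS ha
  obtain ⟨a, ha, b, hb, hab⟩ := hs S (fun a ha => mem_X_of_mem_coreSet (hmem a ha).1) hS'
  have h1 : (P.final Γ).Adj a b := core_le_final ⟨hab, (hmem a ha).1, (hmem b hb).1⟩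
  exact f.valid h1 ((hmem a ha).2.trans (hmem b hb).2.symm)

/-- The core depends only on edges inside `X`, and the star to `A` contains none of these. -/
lemma core_cutStar {A : Finset V} (hA : ∀ v ∈ P.X, v ∉ A) (a : V) :
    P.core (cutStar Γ A a) = P.core Γ := by
  have hadj : ∀ b ∈ P.X, ∀ d ∈ P.X, (cutStar Γ A a).Adj b d ↔ Γ.Adj b d := fun b hb d hd =>
    ⟨fun h => cutStar_le _ _ _ h, fun h => cutStar_adj_of_notMem h (hA b hb) (hA d hd)⟩
  have hset : P.coreSet (cutStar Γ A a) = P.coreSet Γ := by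
    refine Finset.filter_congr fun x hx => ?_
    have h1 : nbrIn (cutStar Γ A a) P.X x = nbrIn Γ P.X x :=
      Finset.filter_congr fun y hy => hadj x hx y hy
    have h2 : ∀ c, (IsCyc (cutStar Γ A a) (2 * P.k + 1) c ∧ (∀ i, c i ∈ P.X) ∧ c 0 = x) ↔
        (IsCyc Γ (2 * P.k + 1) c ∧ (∀ i, c i ∈ P.X) ∧ c 0 = x) := fun c => by
      constructor
      · exact fun h => ⟨h.1.mono (cutStar_le _ _ _), h.2⟩
      · exact fun h => ⟨⟨fun i => (hadj _ (h.2.1 i) _ (h.2.1 _)).2 (h.1.1 i), h.1.2⟩, h.2⟩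
    rw [h1]
    simp only [h2]
  ext b d
  simp only [core, hset]
  constructor
  · exact fun h => ⟨cutStar_le _ _ _ h.1, h.2⟩
  · exact fun h => ⟨(hadj b (mem_X_of_mem_coreSet h.2.1) d (mem_X_of_mem_coreSet h.2.2)).2 h.1, h.2⟩

lemma card_nbrIn_cutStar_le (A B : Finset V) (a b : V) :
    (nbrIn (cutStar Γ A a) B b).card ≤ (nbrIn Γ B b).card :=
  Finset.card_le_card fun x hx => by
    rw [mem_nbrIn] at hx ⊢
    exact ⟨hx.1, cutStar_le _ _ _ hx.2⟩

/-- The degree condition in `Link` survives deletions. Thus the part of a cycle away from `a` can be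
traced in the cut graph, which is independent of the star at `a`. -/
lemma base_cutStar {A : Finset V} (hA : ∀ v ∈ P.X, v ∉ A) {a b d : V}
    (h : (P.base Γ).Adj b d) (hb : b ≠ a) (hd : d ≠ a) : (P.base (cutStar Γ A a)).Adj b d := by
  have hlink : ∀ x y, P.Link Γ x y → P.Link (cutStar Γ A a) x y := fun x y h =>
    ⟨h.1, h.2.imp id fun h => ⟨h.1, (card_nbrIn_cutStar_le A P.X a x).trans h.2⟩⟩
  rcases h with h | ⟨h, h'⟩
  · exact Or.inl (by rwa [core_cutStar hA a])
  · exact Or.inr ⟨cutStar_adj_of_ne h hb hd, h'.imp (hlink _ _) (hlink _ _)⟩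

end Layout
end Construction

/-! ### Cut edges lead to small reachable sets. -/

section Losses

set_option linter.unusedSectionVars false

open scoped Classical

variable {V : Type*} [Fintype V] [DecidableEq V]

namespace Layout

variable (P : Layout V) (Γ : SimpleGraph V)

/-- Steps from `U` to `X` in the base graph. -/
def StepUX (a b : V) : Prop := (P.base Γ).Adj a b ∧ a ∈ P.U ∧ b ∈ P.X

/-- The ends of walks of length `2 * k - 1` from `x` that use an edge of the core. -/
noncomputable def reachU (x : V) : Finset V :=
  (Finset.range (2 * P.k - 1)).biUnion fun i =>
    (nbSet (P.base Γ).Adj)^[2 * P.k - 2 - i] (nbSet (P.core Γ).Adj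
      ((nbSet (P.base Γ).Adj)^[i] {x}))

/-- The ends of walks of length `2 * k - 1` from `u` that use a step from `U` to `X` and later an
edge of the core. -/
noncomputable def reachW (u : V) : Finset V :=
  (Finset.range (2 * P.k - 2)).biUnion fun i => (Finset.range (2 * P.k - 2 - i)).biUnion fun l =>
    (nbSet (P.base Γ).Adj)^[2 * P.k - 3 - i - l] (nbSet (P.core Γ).Adj
      ((nbSet (P.base Γ).Adj)^[l] (nbSet (P.StepUX Γ) ((nbSet (P.base Γ).Adj)^[i] {u}))))

/-- The ends of walks of length `2 * k - 1` from `x` that start with an edge of the core, or whose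
second step leads from `U` to `X`. -/
noncomputable def reachX (x : V) : Finset V :=
  (nbSet (P.base Γ).Adj)^[2 * P.k - 2] (nbSet (P.core Γ).Adj {x}) ∪
    (nbSet (P.base Γ).Adj)^[2 * P.k - 3] (nbSet (P.StepUX Γ) (nbSet (P.base Γ).Adj {x}))

variable {P Γ} {M : ℝ}

lemma card_base_adj_le (hM : ∀ a, ((nbrIn Γ Finset.univ a).card : ℝ) ≤ M) (a : V) :
    (({b | (P.base Γ).Adj a b} : Finset V).card : ℝ) ≤ M := by
  refine le_trans (Nat.cast_le.2 (Finset.card_le_card fun b hb => ?_)) (hM a)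
  rw [mem_nbrIn]
  exact ⟨Finset.mem_univ _, base_le (Finset.mem_filter.1 hb).2⟩

lemma card_core_adj_le (a : V) :
    (({b | (P.core Γ).Adj a b} : Finset V).card : ℝ) ≤ P.D := by
  by_cases ha : a ∈ P.coreSet Γ
  · refine Nat.cast_le.2 (le_trans (Finset.card_le_card fun b hb => ?_)
      (Finset.mem_filter.1 ha).2.1)
    have hb := (Finset.mem_filter.1 hb).2
    rw [mem_nbrIn]
    exact ⟨mem_X_of_mem_coreSet hb.2.2, hb.1⟩
  · rw [Finset.filter_false_of_mem fun b _ hb => ha hb.2.1]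
    simp

lemma card_stepUX_le (a : V) :
    (({b | P.StepUX Γ a b} : Finset V).card : ℝ) ≤ P.D' := by
  by_cases ha : ∃ b, P.StepUX Γ a b
  · obtain ⟨b, hb⟩ := ha
    refine Nat.cast_le.2 (le_trans (Finset.card_le_card fun d hd => ?_)
      (card_nbrIn_le_of_base_adj hb.1 hb.2.1 hb.2.2))
    have hd := (Finset.mem_filter.1 hd).2
    rw [mem_nbrIn]
    exact ⟨hd.2.2, base_le hd.1⟩
  · rw [Finset.filter_false_of_mem fun b _ hb => ha ⟨b, hb⟩]
    simp

/-- The core step contributes `D` instead of `M`; the factor `2 * k` accounts for its position. -/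
lemma card_reachU_le (hM0 : 0 ≤ M) (hM : ∀ a, ((nbrIn Γ Finset.univ a).card : ℝ) ≤ M) (x : V) :
    ((P.reachU Γ x).card : ℝ) ≤ 2 * P.k * (P.D * M ^ (2 * P.k - 2)) := by
  have hb := card_base_adj_le (P := P) hM
  calc ((P.reachU Γ x).card : ℝ) ≤ ∑ i ∈ Finset.range (2 * P.k - 1), (P.D * M ^ (2 * P.k - 2)) := by
        refine le_trans (Nat.cast_le.2 Finset.card_biUnion_le) ?_
        push_cast
        refine Finset.sum_le_sum fun i hi => ?_
        have hi := Finset.mem_range.1 hi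
        refine (card_iterate_nbSet_le hb hM0 (card_nbSet_le card_core_adj_le (Nat.cast_nonneg _)
          (card_iterate_nbSet_le hb hM0 (N := 1) (by simp) i)) _).trans_eq ?_
        rw [show 2 * P.k - 2 = i + (2 * P.k - 2 - i) by omega, pow_add,
          show i + (2 * P.k - 2 - i) - i = 2 * P.k - 2 - i by omega]
        ring
    _ = ((2 * P.k - 1 : ℕ) : ℝ) * (P.D * M ^ (2 * P.k - 2)) := by
        rw [Finset.sum_const, nsmul_eq_mul, Finset.card_range]
    _ ≤ 2 * P.k * (P.D * M ^ (2 * P.k - 2)) := by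
        gcongr
        exact_mod_cast Nat.sub_le _ _

/-- Two of the `2 * k - 1` steps have bounded degree, so one more factor `M` is saved than in
`card_reachU_le`. -/
lemma card_reachW_le (hM0 : 0 ≤ M) (hM : ∀ a, ((nbrIn Γ Finset.univ a).card : ℝ) ≤ M) (u : V) :
    ((P.reachW Γ u).card : ℝ) ≤ (2 * P.k) ^ 2 * (P.D * P.D' * M ^ (2 * P.k - 3)) := by
  have hb := card_base_adj_le (P := P) hM
  set B : ℝ := P.D * P.D' * M ^ (2 * P.k - 3) with hB
  have hB0 : 0 ≤ B := by positivity
  calc ((P.reachW Γ u).card : ℝ)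
      ≤ ∑ i ∈ Finset.range (2 * P.k - 2), ∑ l ∈ Finset.range (2 * P.k - 2 - i), B := by
        refine le_trans (Nat.cast_le.2 Finset.card_biUnion_le) ?_
        push_cast
        refine Finset.sum_le_sum fun i hi => ?_
        refine le_trans (Nat.cast_le.2 Finset.card_biUnion_le) ?_
        push_cast
        refine Finset.sum_le_sum fun l hl => ?_
        have hi := Finset.mem_range.1 hi
        have hl := Finset.mem_range.1 hl
        refine (card_iterate_nbSet_le hb hM0 (card_nbSet_le card_core_adj_le (Nat.cast_nonneg _)
          (card_iterate_nbSet_le hb hM0 (card_nbSet_le card_stepUX_le (Nat.cast_nonneg _)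
          (card_iterate_nbSet_le hb hM0 (N := 1) (by simp) i)) _)) _).trans_eq ?_
        rw [hB, show 2 * P.k - 3 = i + l + (2 * P.k - 3 - i - l) by omega, pow_add, pow_add,
          show i + l + (2 * P.k - 3 - i - l) - i - l = 2 * P.k - 3 - i - l by omega]
        ring
    _ ≤ ∑ i ∈ Finset.range (2 * P.k - 2), (2 * P.k) * B := by
        refine Finset.sum_le_sum fun i _ => ?_
        rw [Finset.sum_const, nsmul_eq_mul, Finset.card_range]
        gcongr
        exact_mod_cast (Nat.sub_le _ _).trans (Nat.sub_le _ _)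
    _ ≤ (2 * P.k) * ((2 * P.k) * B) := by
        rw [Finset.sum_const, nsmul_eq_mul, Finset.card_range]
        gcongr
        exact_mod_cast Nat.sub_le _ _
    _ = _ := by ring

lemma card_reachX_le (hM0 : 0 ≤ M) (hM : ∀ a, ((nbrIn Γ Finset.univ a).card : ℝ) ≤ M) (x : V) :
    ((P.reachX Γ x).card : ℝ) ≤ (P.D + P.D') * M ^ (2 * P.k - 2) := by
  have hb := card_base_adj_le (P := P) hM
  have hk := P.two_le_k
  refine le_trans (Nat.cast_le.2 (Finset.card_union_le _ _)) ?_
  push_cast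
  have h1 := card_iterate_nbSet_le hb hM0 (card_nbSet_le (card_core_adj_le (P := P) (Γ := Γ))
    (Nat.cast_nonneg _) (S := {x}) (N := 1) (by simp)) (2 * P.k - 2)
  have h2 := card_iterate_nbSet_le hb hM0 (card_nbSet_le (card_stepUX_le (P := P) (Γ := Γ))
    (Nat.cast_nonneg _) (card_nbSet_le hb hM0 (S := {x}) (N := 1) (by simp))) (2 * P.k - 3)
  refine (add_le_add h1 h2).trans_eq ?_
  rw [show 2 * P.k - 2 = 2 * P.k - 3 + 1 by omega, pow_succ]
  ring

/-- A cut edge at `u ∈ U` leads to a vertex that can be reached from a neighbour of `u` in `X`. -/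
lemma exists_mem_reachU_of_cutW {w u : V} (h : P.CutW Γ w u) :
    (nbrIn Γ P.X u).card ≤ P.D' ∧ ∃ x ∈ nbrIn Γ P.X u, w ∈ P.reachU (cutStar Γ P.W u) x := by
  obtain ⟨hw, hu, c, hc, h0, h1, h2⟩ := h
  have hk := P.two_le_k
  have hA : ∀ v ∈ P.X, v ∉ P.W := P.notMem_W_of_X
  have hux : (P.base Γ).Adj u (c 2) := h1 ▸ hc.1 1
  refine ⟨card_nbrIn_le_of_base_adj hux hu h2, c 2, mem_nbrIn.2 ⟨h2, base_le hux⟩, ?_⟩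
  -- Modulo the length, the edge inside `X` starts neither at position 0, which is in `W`, nor at
  -- position 1, which is in `U`.
  obtain ⟨i, hi, hi', hi2, hiL⟩ : ∃ i, c i ∈ P.X ∧ c (i + 1) ∈ P.X ∧ 2 ≤ i ∧ i < 2 * P.k + 1 := by
    obtain ⟨i, hi, hi'⟩ := exists_two_mem_X hc
    have e0 : c (i % (2 * P.k + 1)) = c i := (hc.2 _ _).2 (Nat.mod_mod _ _)
    have e1 : c (i % (2 * P.k + 1) + 1) = c (i + 1) := (hc.2 _ _).2 (by simp)
    refine ⟨i % (2 * P.k + 1), e0 ▸ hi, e1 ▸ hi', ?_, Nat.mod_lt _ (by omega)⟩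
    by_contra hlt
    obtain h | h : i % (2 * P.k + 1) = 0 ∨ i % (2 * P.k + 1) = 1 := by omega
    · rw [h, h0] at e0
      exact hA _ hi (e0 ▸ hw)
    · rw [h, h1] at e0
      exact P.notMem_U_of_X _ hi (e0 ▸ hu)
  have hne : ∀ j, 2 ≤ j → j ≤ 2 * P.k + 1 → c j ≠ u := fun j hj hj' =>
    h1 ▸ (hc.ne (i := 1) (j := j) (by omega) (by omega)).symm
  have hadj : ∀ j, 2 ≤ j → j < 2 * P.k + 1 →
      (P.base (cutStar Γ P.W u)).Adj (c j) (c (j + 1)) := fun j hj hj' =>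
    base_cutStar hA (hc.1 j) (hne j hj (by omega)) (hne (j + 1) (by omega) (by omega))
  refine Finset.mem_biUnion.2 ⟨i - 2, Finset.mem_range.2 (by omega), ?_⟩
  have m1 : c (2 + (i - 2)) ∈ (nbSet (P.base (cutStar Γ P.W u)).Adj)^[i - 2] {c 2} :=
    mem_iterate_nbSet c (by simp) _ fun j hj hj' => hadj j hj (by omega)
  have m2 : c (i + 1) ∈ nbSet (P.core (cutStar Γ P.W u)).Adj
      ((nbSet (P.base (cutStar Γ P.W u)).Adj)^[i - 2] {c 2}) := by
    refine mem_nbSet_of_rel m1 ?_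
    rw [core_cutStar hA, show 2 + (i - 2) = i by omega]
    exact core_adj_of_base_adj (hc.1 i) hi hi'
  have m3 := mem_iterate_nbSet c m2 (2 * P.k - 2 - (i - 2))
    fun j hj hj' => hadj j (by omega) (by omega)
  rwa [show i + 1 + (2 * P.k - 2 - (i - 2)) = 2 * P.k + 1 by omega, hc.apply_length, h0] at m3

/-- A cut edge at `x ∈ X` leads to a vertex that can be reached from a neighbour of `x` in the
core. -/
lemma exists_mem_reachX_of_cutX {x u : V} (h : P.CutX Γ x u) :
    ∃ y, (P.core Γ).Adj x y ∧ u ∈ P.reachX (cutStar Γ P.U x) y := by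
  obtain ⟨hx, hu, c, hc, h0, h1, h2, hW⟩ := h
  have hk := P.two_le_k
  have hA : ∀ v ∈ P.X, v ∉ P.U := P.notMem_U_of_X
  set L := 2 * P.k + 1 with hL
  have hc0 := hc.1 0
  rw [zero_add, h1] at hc0
  refine ⟨c 0, core_adj_of_base_adj hc0.symm hx h0, ?_⟩
  have hne : ∀ j, 2 ≤ j → j ≤ L → c j ≠ x := fun j hj hj' =>
    h1 ▸ (hc.ne (i := 1) (j := j) (by omega) (by omega)).symm
  -- Follow the cycle backwards from `c 0` to `u = c 2`, avoiding `x = c 1`.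
  set d : ℕ → V := fun j => c (L - j) with hd
  have hadj' : ∀ j, j + 2 < L → (P.base Γ).Adj (d j) (d (j + 1)) := fun j hj => by
    have := (hc.1 (L - (j + 1))).symm
    rwa [show L - (j + 1) + 1 = L - j by omega] at this
  have hadj : ∀ j, j + 2 < L → (P.base (cutStar Γ P.U x)).Adj (d j) (d (j + 1)) := fun j hj =>
    base_cutStar hA (hadj' j hj) (hne _ (by omega) (by omega)) (hne _ (by omega) (by omega))
  have hd0 : d 0 = c 0 := by simp only [hd, Nat.sub_zero]; exact hc.apply_length
  have hdL : d (L - 2) = u := by simp only [hd]; rw [show L - (L - 2) = 2 by omega, h2]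
  -- As the cycle avoids `W`, the backward walk either starts with a core edge or goes to `U` and at
  -- once returns to `X`; both cases include a step of bounded degree.
  rcases P.cover (d 1) with hd1 | hd1 | hd1
  · refine Finset.mem_union_left _ ?_
    have m1 : d 1 ∈ nbSet (P.core (cutStar Γ P.U x)).Adj {c 0} := by
      refine mem_nbSet_of_rel (Finset.mem_singleton_self _) ?_
      rw [core_cutStar hA, ← hd0]
      exact core_adj_of_base_adj (hadj' 0 (by omega)) (hd0 ▸ h0) hd1
    have m2 := mem_iterate_nbSet d m1 (2 * P.k - 2) fun j hj hj' => hadj j (by omega)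
    rwa [show 1 + (2 * P.k - 2) = L - 2 by omega, hdL] at m2
  · refine Finset.mem_union_right _ ?_
    have hd2 : d 2 ∈ P.X := by
      rcases P.cover (d 2) with h | h | h
      · exact h
      · exact absurd h (notMem_U_of_base_adj (hadj' 1 (by omega)) hd1)
      · exact absurd h (hW _)
    have m0 : d 1 ∈ nbSet (P.base (cutStar Γ P.U x)).Adj {c 0} := by
      refine mem_nbSet_of_rel (Finset.mem_singleton_self _) ?_
      rw [← hd0]
      exact hadj 0 (by omega)
    have m1 : d 2 ∈ nbSet (P.StepUX (cutStar Γ P.U x)) (nbSet (P.base (cutStar Γ P.U x)).Adj {c 0}) :=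
      mem_nbSet_of_rel m0 ⟨hadj 1 (by omega), hd1, hd2⟩
    have m2 := mem_iterate_nbSet d m1 (2 * P.k - 3) fun j hj hj' => hadj j (by omega)
    rwa [show 2 + (2 * P.k - 3) = L - 2 by omega, hdL] at m2
  · exact absurd hd1 (hW _)

/-- A sequence in the base graph that runs from `U` to `X` contains a step from `U` to `X`. -/
lemma exists_step_U_X {d : ℕ → V} {j : ℕ} (hd : ∀ i < j, (P.base Γ).Adj (d i) (d (i + 1)))
    (h0 : d 0 ∈ P.U) (hj : d j ∈ P.X) : ∃ i < j, d i ∈ P.U ∧ d (i + 1) ∈ P.X := by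
  induction j with
  | zero => exact absurd h0 (P.notMem_U_of_X _ hj)
  | succ j ih =>
    rcases P.cover (d j) with h | h | h
    · obtain ⟨i, hi, hi'⟩ := ih (fun i hi => hd i (by omega)) h
      exact ⟨i, by omega, hi'⟩
    · exact ⟨j, by omega, h, hj⟩
    · exact absurd (mem_U_of_base_adj_W (hd j (by omega)) h) (P.notMem_U_of_X _ hj)

/-- A cut edge at `w ∈ W` leads to a vertex that can be reached from another neighbour of `w`. -/
lemma exists_mem_reachW_of_cutW {w u : V} (h : P.CutW Γ w u) :
    ∃ v ∈ nbrIn Γ P.U w, v ≠ u ∧ u ∈ P.reachW (cutStar Γ P.U w) v := by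
  obtain ⟨hw, hu, c, hc, h0, h1, h2⟩ := h
  have hk := P.two_le_k
  have hA : ∀ v ∈ P.X, v ∉ P.U := P.notMem_U_of_X
  set L := 2 * P.k + 1 with hL
  have hlast := (hc.1 (L - 1)).symm
  rw [show L - 1 + 1 = L by omega, hc.apply_length, h0] at hlast
  have hvU : c (L - 1) ∈ P.U := mem_U_of_base_adj_W hlast hw
  refine ⟨c (L - 1), mem_nbrIn.2 ⟨hvU, base_le hlast⟩,
    h1 ▸ (hc.ne (i := 1) (j := L - 1) (by omega) (by omega)).symm, ?_⟩
  have hne : ∀ j, 1 ≤ j → j < L → c j ≠ w := fun j hj hj' =>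
    h0 ▸ (hc.ne (i := 0) (j := j) (by omega) (by omega)).symm
  -- Follow the cycle backwards from the other neighbour of `w` to `u = c 1`, avoiding `w = c 0`.
  set d : ℕ → V := fun j => c (L - 1 - j) with hd
  have hadj' : ∀ j, j + 2 < L → (P.base Γ).Adj (d j) (d (j + 1)) := fun j hj => by
    have := (hc.1 (L - 1 - (j + 1))).symm
    rwa [show L - 1 - (j + 1) + 1 = L - 1 - j by omega] at this
  have hadj : ∀ j, j + 2 < L → (P.base (cutStar Γ P.U w)).Adj (d j) (d (j + 1)) := fun j hj =>
    base_cutStar hA (hadj' j hj) (hne _ (by omega) (by omega)) (hne _ (by omega) (by omega))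
  obtain ⟨q, hq, hq', hqL⟩ : ∃ q, d q ∈ P.X ∧ d (q + 1) ∈ P.X ∧ q + 2 < L := by
    obtain ⟨i, hi, hi'⟩ := exists_two_mem_X hc
    have e0 : c (i % L) = c i := (hc.2 _ _).2 (Nat.mod_mod _ _)
    have e1 : c (i % L + 1) = c (i + 1) := (hc.2 _ _).2 (by simp)
    have hlt : i % L < L := Nat.mod_lt _ (by omega)
    have hi0 : i % L ≠ 0 := fun h => by
      rw [h, h0] at e0
      exact P.notMem_W_of_X _ hi (e0 ▸ hw)
    have hiL : i % L ≠ L - 1 := fun h => by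
      rw [h] at e0
      exact hA _ hi (e0 ▸ hvU)
    refine ⟨L - 1 - (i % L + 1), ?_, ?_, by omega⟩
    · simp only [hd]
      rw [show L - 1 - (L - 1 - (i % L + 1)) = i % L + 1 by omega, e1]
      exact hi'
    · simp only [hd]
      rw [show L - 1 - (L - 1 - (i % L + 1) + 1) = i % L by omega, e0]
      exact hi
  have hdU : d 0 ∈ P.U := hvU
  -- The walk starts in `U`, so before its core edge it enters `X` from `U`: this is the second step
  -- of bounded degree.
  obtain ⟨i, hiq, hiU, hiX⟩ := exists_step_U_X (fun i hi => hadj' i (by omega)) hdU hq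
  refine Finset.mem_biUnion.2 ⟨i, Finset.mem_range.2 (by omega), Finset.mem_biUnion.2
    ⟨q - (i + 1), Finset.mem_range.2 (by omega), ?_⟩⟩
  have m1 := mem_iterate_nbSet (r := (P.base (cutStar Γ P.U w)).Adj) (S := {c (L - 1)}) d (s := 0)
    (by simp [hd]) i fun j hj hj' => hadj j (by omega)
  rw [zero_add] at m1
  have m2 := mem_nbSet_of_rel (r := P.StepUX (cutStar Γ P.U w)) m1 ⟨hadj i (by omega), hiU, hiX⟩
  have m3 := mem_iterate_nbSet d m2 (q - (i + 1)) fun j hj hj' => hadj j (by omega)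
  rw [show i + 1 + (q - (i + 1)) = q by omega] at m3
  have m4 := mem_nbSet_of_rel (r := (P.core (cutStar Γ P.U w)).Adj) m3 (by
    rw [core_cutStar hA]
    exact core_adj_of_base_adj (hadj' q hqL) hq hq')
  have m5 := mem_iterate_nbSet d m4 (2 * P.k - 3 - i - (q - (i + 1)))
    fun j hj hj' => hadj j (by omega)
  rw [show q + 1 + (2 * P.k - 3 - i - (q - (i + 1))) = L - 2 by omega] at m5
  have : d (L - 2) = u := by simp only [hd]; rw [show L - 1 - (L - 2) = 1 by omega, h1]
  rwa [this] at m5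

end Layout
end Losses

/-! ### Degrees in the final graph in terms of the losses. -/

section MinDegree

set_option linter.unusedSectionVars false

open scoped Classical

variable {V : Type*} [Fintype V] [DecidableEq V]

namespace Layout

variable (P : Layout V) (Γ : SimpleGraph V)

/-- The vertices of `U` with at least `D'` neighbours in `X`. -/
noncomputable def heavy : Finset V := {u ∈ P.U | P.D' ≤ (nbrIn Γ P.X u).card}

/-- The neighbours of `w` that can be reached from another neighbour of `w`. -/
noncomputable def lossW (w : V) : Finset V :=
  {u ∈ nbrIn Γ P.U w | ∃ v ∈ nbrIn Γ P.U w, v ≠ u ∧ u ∈ P.reachW (cutStar Γ P.U w) v}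

variable {P Γ}

lemma final_adj_W {w u : V} (hw : w ∈ P.W) (hu : u ∈ P.U) (h : Γ.Adj w u) (hcut : ¬ P.CutW Γ w u) :
    (P.final Γ).Adj w u := by
  refine ⟨Or.inr ⟨h, Or.inr ⟨hu, Or.inl hw⟩⟩, ?_, ?_⟩
  · rintro (h | h)
    · exact hcut h
    · exact P.notMem_W_of_X w h.1 hw
  · rintro (h | h)
    · exact P.notMem_W_of_U u hu h.1
    · exact P.notMem_U_of_X u h.1 hu

lemma final_adj_X {x u : V} (hx : x ∈ P.X) (hu : u ∈ P.U) (h : Γ.Adj x u)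
    (hd : (nbrIn Γ P.X u).card ≤ P.D') (hcut : ¬ P.CutX Γ x u) :
    (P.final Γ).Adj x u := by
  refine ⟨Or.inr ⟨h, Or.inr ⟨hu, Or.inr ⟨hx, hd⟩⟩⟩, ?_, ?_⟩
  · rintro (h | h)
    · exact P.notMem_W_of_X x hx h.1
    · exact hcut h
  · rintro (h | h)
    · exact P.notMem_W_of_U u hu h.1
    · exact P.notMem_U_of_X u h.1 hu

lemma card_nbrIn_le_of_mem_W {w : V} (hw : w ∈ P.W) :
    ((nbrIn Γ P.U w).card : ℝ) ≤
      ((nbrIn (P.final Γ) Finset.univ w).card : ℝ) + ((P.lossW Γ w).card : ℝ) := by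
  have : nbrIn Γ P.U w ⊆ nbrIn (P.final Γ) Finset.univ w ∪ P.lossW Γ w := by
    intro u hu
    have hu' := mem_nbrIn.1 hu
    by_cases hcut : P.CutW Γ w u
    · exact Finset.mem_union_right _ (Finset.mem_filter.2 ⟨hu, exists_mem_reachW_of_cutW hcut⟩)
    · exact Finset.mem_union_left _
        (mem_nbrIn.2 ⟨Finset.mem_univ _, final_adj_W hw hu'.1 hu'.2 hcut⟩)
  exact_mod_cast (Finset.card_le_card this).trans (Finset.card_union_le _ _)

/-- A vertex with more than `D'` neighbours in `X` has no base edge to `X` and so loses no edge to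
`W`; otherwise at most `D'` neighbours in `X` account for at most `t` losses each. -/
lemma card_nbrIn_le_of_mem_U {u : V} (hu : u ∈ P.U) {t : ℝ} (ht : 0 ≤ t)
    (h : ∀ x ∈ P.X, ((nbrIn Γ P.W u ∩ P.reachU (cutStar Γ P.W u) x).card : ℝ) ≤ t) :
    ((nbrIn Γ P.W u).card : ℝ) ≤ ((nbrIn (P.final Γ) Finset.univ u).card : ℝ) + P.D' * t := by
  by_cases hd : (nbrIn Γ P.X u).card ≤ P.D'
  · have : nbrIn Γ P.W u ⊆ nbrIn (P.final Γ) Finset.univ u ∪ (nbrIn Γ P.X u).biUnion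
        fun x => nbrIn Γ P.W u ∩ P.reachU (cutStar Γ P.W u) x := by
      intro w hw
      have hw' := mem_nbrIn.1 hw
      by_cases hcut : P.CutW Γ w u
      · obtain ⟨-, x, hx, hwx⟩ := exists_mem_reachU_of_cutW hcut
        exact Finset.mem_union_right _
          (Finset.mem_biUnion.2 ⟨x, hx, Finset.mem_inter.2 ⟨hw, hwx⟩⟩)
      · exact Finset.mem_union_left _
          (mem_nbrIn.2 ⟨Finset.mem_univ _, (final_adj_W hw'.1 hu hw'.2.symm hcut).symm⟩)
    refine (Nat.cast_le.2 ((Finset.card_le_card this).trans (Finset.card_union_le _ _))).trans ?_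
    push_cast
    gcongr
    calc _ ≤ ∑ x ∈ nbrIn Γ P.X u, ((nbrIn Γ P.W u ∩ P.reachU (cutStar Γ P.W u) x).card : ℝ) := by
          exact_mod_cast Finset.card_biUnion_le
      _ ≤ ∑ x ∈ nbrIn Γ P.X u, t := Finset.sum_le_sum fun x hx => h x (mem_nbrIn.1 hx).1
      _ = (nbrIn Γ P.X u).card * t := by rw [Finset.sum_const, nsmul_eq_mul]
      _ ≤ P.D' * t := by gcongr
  · have : nbrIn Γ P.W u ⊆ nbrIn (P.final Γ) Finset.univ u := by
      intro w hw
      have hw' := mem_nbrIn.1 hw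
      exact mem_nbrIn.2 ⟨Finset.mem_univ _, (final_adj_W hw'.1 hu hw'.2.symm
        fun hcut => hd (exists_mem_reachU_of_cutW hcut).1).symm⟩
    have h1 : ((nbrIn Γ P.W u).card : ℝ) ≤ (nbrIn (P.final Γ) Finset.univ u).card :=
      Nat.cast_le.2 (Finset.card_le_card this)
    have : 0 ≤ P.D' * t := by positivity
    linarith

/-- Deleting the star at `x` costs `u` at most one neighbour in `X`, so more than `D'` become at
least `D'`; hence the weak inequality in `heavy`. -/
lemma mem_heavy_cutStar {x u : V} (hu : u ∈ P.U) (hd : ¬ (nbrIn Γ P.X u).card ≤ P.D') :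
    u ∈ P.heavy (cutStar Γ P.U x) := by
  refine Finset.mem_filter.2 ⟨hu, ?_⟩
  have : (nbrIn Γ P.X u).erase x ⊆ nbrIn (cutStar Γ P.U x) P.X u := by
    intro y hy
    obtain ⟨hyx, hy⟩ := Finset.mem_erase.1 hy
    obtain ⟨hyX, hy⟩ := mem_nbrIn.1 hy
    by_cases hux : u = x
    · refine mem_nbrIn.2 ⟨hyX, ?_⟩
      rw [cutStar, SimpleGraph.deleteEdges_adj]
      refine ⟨hy, ?_⟩
      rintro ⟨b, hb, hbe⟩
      rcases Sym2.eq_iff.1 hbe with h | h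
      · exact P.notMem_U_of_X y hyX (h.2 ▸ hb)
      · exact hyx h.2
    · exact mem_nbrIn.2 ⟨hyX, cutStar_adj_of_ne hy hux hyx⟩
  have h1 := Finset.card_le_card this
  have h2 := Finset.pred_card_le_card_erase (s := nbrIn Γ P.X u) (a := x)
  omega

lemma heavy_cutStar_subset (x : V) (A : Finset V) : P.heavy (cutStar Γ A x) ⊆ P.heavy Γ := by
  intro u hu
  obtain ⟨hu, h⟩ := Finset.mem_filter.1 hu
  exact Finset.mem_filter.2 ⟨hu, h.trans (card_nbrIn_cutStar_le _ _ _ _)⟩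

/-- Edges are lost either to cuts, at most `t` for each of at most `D` core neighbours, or because
the end in `U` has too many neighbours in `X`. -/
lemma card_nbrIn_le_of_mem_X {x : V} (hx : x ∈ P.X) {t : ℝ} (ht : 0 ≤ t)
    (h : ∀ y ∈ P.X, ((nbrIn Γ P.U x ∩ P.reachX (cutStar Γ P.U x) y).card : ℝ) ≤ t) :
    ((nbrIn Γ P.U x).card : ℝ) ≤ ((nbrIn (P.final Γ) Finset.univ x).card : ℝ) + P.D * t +
      ((nbrIn Γ P.U x ∩ P.heavy (cutStar Γ P.U x)).card : ℝ) := by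
  have : nbrIn Γ P.U x ⊆ (nbrIn (P.final Γ) Finset.univ x ∪
      ({y | (P.core Γ).Adj x y} : Finset V).biUnion
        fun y => nbrIn Γ P.U x ∩ P.reachX (cutStar Γ P.U x) y) ∪
      (nbrIn Γ P.U x ∩ P.heavy (cutStar Γ P.U x)) := by
    intro u hu
    have hu' := mem_nbrIn.1 hu
    by_cases hd : (nbrIn Γ P.X u).card ≤ P.D'
    · refine Finset.mem_union_left _ ?_
      by_cases hcut : P.CutX Γ x u
      · obtain ⟨y, hy, huy⟩ := exists_mem_reachX_of_cutX hcut
        exact Finset.mem_union_right _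
          (Finset.mem_biUnion.2 ⟨y, by simpa using hy, Finset.mem_inter.2 ⟨hu, huy⟩⟩)
      · exact Finset.mem_union_left _
          (mem_nbrIn.2 ⟨Finset.mem_univ _, final_adj_X hx hu'.1 hu'.2 hd hcut⟩)
    · exact Finset.mem_union_right _ (Finset.mem_inter.2 ⟨hu, mem_heavy_cutStar hu'.1 hd⟩)
  refine (Nat.cast_le.2 ((Finset.card_le_card this).trans ((Finset.card_union_le _ _).trans
    (Nat.add_le_add_right (Finset.card_union_le _ _) _)))).trans ?_
  push_cast
  gcongr
  calc _ ≤ ∑ y ∈ ({y | (P.core Γ).Adj x y} : Finset V),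
        ((nbrIn Γ P.U x ∩ P.reachX (cutStar Γ P.U x) y).card : ℝ) := by
        exact_mod_cast Finset.card_biUnion_le
    _ ≤ ∑ y ∈ ({y | (P.core Γ).Adj x y} : Finset V), t := Finset.sum_le_sum fun y hy =>
        h y (mem_X_of_mem_coreSet (Finset.mem_filter.1 hy).2.2.2)
    _ = (({y | (P.core Γ).Adj x y} : Finset V).card : ℝ) * t := by
        rw [Finset.sum_const, nsmul_eq_mul]
    _ ≤ P.D * t := mul_le_mul_of_nonneg_right (card_core_adj_le x) ht

lemma card_coreSet_ge :
    (P.X.card : ℝ) ≤ ((P.coreSet Γ).card : ℝ) +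
      (({x ∈ P.X | P.D + 1 ≤ (nbrIn Γ P.X x).card}).card : ℝ) +
      (({x ∈ P.X | ∃ c, IsCyc Γ (2 * P.k + 1) c ∧ (∀ i, c i ∈ P.X) ∧ c 0 = x}).card : ℝ) := by
  have : P.X ⊆ (P.coreSet Γ ∪ {x ∈ P.X | P.D + 1 ≤ (nbrIn Γ P.X x).card}) ∪
      {x ∈ P.X | ∃ c, IsCyc Γ (2 * P.k + 1) c ∧ (∀ i, c i ∈ P.X) ∧ c 0 = x} := by
    intro x hx
    by_cases h1 : (nbrIn Γ P.X x).card ≤ P.D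
    · by_cases h2 : ∃ c, IsCyc Γ (2 * P.k + 1) c ∧ (∀ i, c i ∈ P.X) ∧ c 0 = x
      · exact Finset.mem_union_right _ (Finset.mem_filter.2 ⟨hx, h2⟩)
      · exact Finset.mem_union_left _ (Finset.mem_union_left _ (Finset.mem_filter.2 ⟨hx, h1, h2⟩))
    · exact Finset.mem_union_left _ (Finset.mem_union_right _
        (Finset.mem_filter.2 ⟨hx, by omega⟩))
  exact_mod_cast (Finset.card_le_card this).trans ((Finset.card_union_le _ _).trans
    (Nat.add_le_add_right (Finset.card_union_le _ _) _))

end Layout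
end MinDegree

/-! ### Probabilities of the bad events. -/

section BadEvents

set_option linter.unusedSectionVars false

open scoped Classical

section Generic

variable {V : Type*} [Fintype V] [DecidableEq V] {P : Layout V} {p : unitInterval}

lemma graphProb_card_nbrIn_ge_le (A : Finset V) (a : V) {t : ℝ} (ht : 0 < t) :
    graphProb p {Γ | t ≤ ((nbrIn Γ A a).card : ℝ)} ≤ A.card * p / t := by
  refine (graphProb_card_ge_le A (fun b Γ => Γ.Adj a b) ht).trans ?_
  gcongr
  rw [← nsmul_eq_mul]
  refine Finset.sum_le_card_nsmul _ _ _ fun b _ => ?_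
  by_cases hab : a = b
  · subst hab
    have : {Γ : SimpleGraph V | Γ.Adj a a} = ∅ := by ext; simp
    rw [this]
    simpa [graphProb] using p.2.1
  · have := graphProb_edges_subset_le p (B := {s(a, b)}) (by simpa [allEdges] using hab)
    simpa using this

lemma graphProb_maxDegree_le {n : ℝ} (hn : (Fintype.card V : ℝ) = n) :
    graphProb p {Γ : SimpleGraph V | ∃ a ∈ (Finset.univ : Finset V),
      3 * (p * n) ≤ ((nbrIn Γ Finset.univ a).card : ℝ)} ≤ n * Real.exp (-(p * n)) := by
  rw [← hn]
  refine graphProb_exists_le_of_le Finset.univ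
    (fun a (Γ : SimpleGraph V) =>
      3 * (p * (Fintype.card V : ℝ)) ≤ ((nbrIn Γ Finset.univ a).card : ℝ)) fun a _ => ?_
  have h1 : ∀ Γ : SimpleGraph V, nbrIn Γ Finset.univ a = nbrIn Γ (Finset.univ.erase a) a := by
    intro Γ
    ext b
    simp only [mem_nbrIn, Finset.mem_univ, true_and, Finset.mem_erase, and_true]
    exact ⟨fun h => ⟨h.ne', h⟩, fun h => h.2⟩
  simp only [h1]
  refine graphProb_nbrIn_le p (Finset.notMem_erase a _)
    (fun s => 3 * (p * (Fintype.card V : ℝ)) ≤ (s.card : ℝ)) ?_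
  refine bernProb_card_ge_three_mul_le p.2.1 p.2.2 ?_
  exact_mod_cast (Finset.card_le_univ _)

lemma graphProb_nbrIn_small_le {A : Finset V} {a : V} (ha : a ∉ A) {δ : ℝ} (h0 : 0 ≤ δ)
    (h1 : δ ≤ 1) :
    graphProb p {Γ | ((nbrIn Γ A a).card : ℝ) ≤ (1 - δ) * (p * A.card)} ≤
      Real.exp (-(δ ^ 2 / 4 * (p * A.card))) :=
  graphProb_nbrIn_le p ha (fun s => (s.card : ℝ) ≤ (1 - δ) * (p * A.card))
    (bernProb_card_le_le p.2.1 p.2.2 h0 h1)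

/-- A vertex has few neighbours in a small set that is determined by the other edges. -/
lemma graphProb_card_nbrIn_inter_ge_le {A : Finset V} {a : V} (ha : a ∉ A)
    (T : SimpleGraph V → Finset V) {τ t : ℝ} :
    graphProb p {Γ | ((T (cutStar Γ A a)).card : ℝ) ≤ τ ∧
      t ≤ ((nbrIn Γ A a ∩ T (cutStar Γ A a)).card : ℝ)} ≤ Real.exp (-t + 2 * p * τ) := by
  refine graphProb_cutStar_nbrIn_le p ha
    (fun H s => ((T H).card : ℝ) ≤ τ ∧ t ≤ ((s ∩ T H).card : ℝ)) fun H => ?_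
  have hp0 : (0 : ℝ) ≤ p := p.2.1
  by_cases hH : ((T H).card : ℝ) ≤ τ
  · refine (bernProb_mono p.2.1 p.2.2 fun s _ h => h.2).trans
      ((bernProb_card_inter_ge_le p.2.1 p.2.2 (T H) t).trans ?_)
    rw [Real.exp_le_exp]
    gcongr
  · simp only [hH, false_and, bernProb, if_false]
    have := bernExp_const_mul (E := A) (p := (p : ℝ)) (f := fun _ => 1) 0
    simp only [zero_mul] at this
    rw [this]
    positivity

/-- Markov's inequality twice: for the degree of one vertex into `X`, then for the number of heavy
vertices. -/
lemma graphProb_heavy_le {τ : ℝ} (hτ : 0 < τ) (hD' : 0 < P.D') :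
    graphProb p {Γ | τ ≤ ((P.heavy Γ).card : ℝ)} ≤
      P.U.card * (P.X.card * p / P.D') / τ := by
  refine (graphProb_card_ge_le P.U
    (fun u (Γ : SimpleGraph V) => P.D' ≤ (nbrIn Γ P.X u).card) hτ).trans ?_
  gcongr
  rw [← nsmul_eq_mul]
  refine Finset.sum_le_card_nsmul _ _ _ fun u _ => ?_
  have := graphProb_card_nbrIn_ge_le (p := p) P.X u (t := (P.D' : ℝ)) (by exact_mod_cast hD')
  simpa only [Nat.cast_le] using this

lemma graphProb_high_degree_le {t : ℝ} (ht : 0 < t) :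
    graphProb p {Γ | t ≤ (({x ∈ P.X | P.D + 1 ≤ (nbrIn Γ P.X x).card}).card : ℝ)} ≤
      P.X.card * (P.X.card * p / (P.D + 1)) / t := by
  refine (graphProb_card_ge_le P.X
    (fun u (Γ : SimpleGraph V) => P.D + 1 ≤ (nbrIn Γ P.X u).card) ht).trans ?_
  gcongr
  rw [← nsmul_eq_mul]
  refine Finset.sum_le_card_nsmul _ _ _ fun u _ => ?_
  have := graphProb_card_nbrIn_ge_le (p := p) P.X u (t := ((P.D + 1 : ℕ) : ℝ))
    (by positivity)
  simp only [Nat.cast_le] at this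
  push_cast at this
  exact this

/-- The expected number of cycles of a given length inside a set. -/
lemma graphProb_cycles_le {L : ℕ} (hL : 3 ≤ L) (X : Finset V) {t : ℝ} (ht : 0 < t) :
    graphProb p {Γ : SimpleGraph V | t ≤
      (({x ∈ X | ∃ c, IsCyc Γ L c ∧ (∀ i, c i ∈ X) ∧ c 0 = x}).card : ℝ)} ≤
      (X.card * p : ℝ) ^ L / t := by
  have hL0 : 0 < L := by omega
  let I : Finset (Fin L → V) := {φ ∈ Fintype.piFinset fun _ => X | Function.Injective φ}
  let nx : Fin L → Fin L := fun i => ⟨(i + 1) % L, Nat.mod_lt _ hL0⟩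
  let S : (Fin L → V) → SimpleGraph V → Prop := fun φ Γ => ∀ i, Γ.Adj (φ i) (φ (nx i))
  have hnx : ∀ i : Fin L, (nx i : ℕ) = if (i : ℕ) + 1 < L then (i : ℕ) + 1 else 0 := by
    intro i
    change ((i : ℕ) + 1) % L = _
    split_ifs with h
    · exact Nat.mod_eq_of_lt h
    · rw [show (i : ℕ) + 1 = L by omega, Nat.mod_self]
  have hsub : {Γ : SimpleGraph V | t ≤
      (({x ∈ X | ∃ c, IsCyc Γ L c ∧ (∀ i, c i ∈ X) ∧ c 0 = x}).card : ℝ)} ⊆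
      {Γ | t ≤ (({φ ∈ I | S φ Γ}).card : ℝ)} := by
    intro Γ hΓ
    rw [Set.mem_ofPred_eq] at hΓ ⊢
    refine le_trans hΓ (Nat.cast_le.2 ?_)
    refine Finset.card_le_card_of_surjOn (fun φ => φ ⟨0, hL0⟩) ?_
    intro x hx
    obtain ⟨-, c, hc, hcX, hc0⟩ := (Finset.mem_filter.1 (Finset.mem_coe.1 hx))
    refine ⟨fun i => c i, ?_, hc0⟩
    simp only [Finset.coe_filter, Set.mem_ofPred_eq]
    refine ⟨Finset.mem_filter.2 ⟨Fintype.mem_piFinset.2 fun i => hcX i, ?_⟩, ?_⟩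
    · intro i j hij
      have := (hc.2 i j).1 hij
      rw [Nat.mod_eq_of_lt i.2, Nat.mod_eq_of_lt j.2] at this
      exact Fin.ext this
    · intro i
      have h1 := hc.1 i
      have h2 : c (nx i) = c (i + 1) := (hc.2 _ _).2 (Nat.mod_mod _ _)
      simpa only [h2] using h1
  refine (graphProb_mono hsub).trans ((graphProb_card_ge_le I S ht).trans ?_)
  gcongr
  have hprob : ∀ φ ∈ I, graphProb p {Γ | S φ Γ} ≤ (p : ℝ) ^ L := by
    intro φ hφ
    have hinj : Function.Injective φ := (Finset.mem_filter.1 hφ).2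
    let e : Fin L → Sym2 V := fun i => s(φ i, φ (nx i))
    -- Two positions could share an edge only with reversed ends, which is impossible for `L ≥ 3`.
    have he : Function.Injective e := by
      intro i j hij
      rcases Sym2.eq_iff.1 hij with h | h
      · exact hinj h.1
      · have h1 := congrArg Fin.val (hinj h.1)
        have h2 := congrArg Fin.val (hinj h.2)
        rw [hnx] at h1 h2
        apply Fin.ext
        have := i.2
        have := j.2
        split_ifs at h1 h2 <;> omega
    have hcard : (Finset.univ.image e).card = L := by
      rw [Finset.card_image_of_injective _ he, Finset.card_univ, Fintype.card_fin]
    have := graphProb_edges_subset_le p (B := Finset.univ.image e) (by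
      intro x hx
      obtain ⟨i, -, rfl⟩ := Finset.mem_image.1 hx
      simp only [allEdges, Finset.mem_filter, Finset.mem_univ, true_and]
      change ¬ (s(φ i, φ (nx i))).IsDiag
      rw [Sym2.mk_isDiag_iff]
      intro h
      have h1 := congrArg Fin.val (hinj h)
      rw [hnx] at h1
      have := i.2
      split_ifs at h1 <;> omega)
    rw [hcard] at this
    refine le_trans (graphProb_mono ?_) this
    intro Γ hΓ x hx
    obtain ⟨i, -, rfl⟩ := Finset.mem_image.1 hx
    exact hΓ i
  have hI : (I.card : ℝ) ≤ (X.card : ℝ) ^ L := by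
    have : I.card ≤ X.card ^ L := by
      refine (Finset.card_filter_le _ _).trans_eq ?_
      simp
    exact_mod_cast this
  calc ∑ φ ∈ I, graphProb p {Γ | S φ Γ} ≤ I.card * (p : ℝ) ^ L := by
        rw [← nsmul_eq_mul]
        exact Finset.sum_le_card_nsmul _ _ _ hprob
    _ ≤ (X.card : ℝ) ^ L * (p : ℝ) ^ L := by
        have : (0 : ℝ) ≤ p := p.2.1
        gcongr
    _ = _ := by rw [mul_pow]

/-- The probability that some set of `s` vertices in `X` is independent. -/
lemma graphProb_indep_le (X : Finset V) (s : ℕ) :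
    graphProb p {Γ : SimpleGraph V | ∃ S ∈ X.powersetCard s, ∀ a ∈ S, ∀ b ∈ S, ¬ Γ.Adj a b} ≤
      2 ^ X.card * (1 - (p : ℝ)) ^ (s.choose 2) := by
  have hp : (0 : ℝ) ≤ 1 - p := by linarith [p.2.2]
  refine (graphProb_exists_le_of_le (δ := (1 - (p : ℝ)) ^ (s.choose 2)) _
    (fun S (Γ : SimpleGraph V) => ∀ a ∈ S, ∀ b ∈ S, ¬ Γ.Adj a b) fun S hS => ?_).trans ?_
  · obtain ⟨-, hS⟩ := Finset.mem_powersetCard.1 hS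
    let B : Finset (Sym2 V) := {e ∈ S.sym2 | ¬ e.IsDiag}
    have hB : B.card = s.choose 2 := by
      have h1 := Sym2.card_image_offDiag S
      rw [hS] at h1
      rw [← h1]
      congr 1
      ext e
      induction e with
      | _ a b =>
        simp only [B, Finset.mem_filter, Finset.mk_mem_sym2_iff, Sym2.mk_isDiag_iff,
          Finset.mem_image, Finset.mem_offDiag, Prod.exists]
        constructor
        · rintro ⟨⟨ha, hb⟩, hab⟩
          exact ⟨a, b, ⟨ha, hb, hab⟩, rfl⟩
        · rintro ⟨x, y, ⟨hx, hy, hxy⟩, h⟩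
          rcases Sym2.eq_iff.1 h with ⟨rfl, rfl⟩ | ⟨rfl, rfl⟩
          · exact ⟨⟨hx, hy⟩, hxy⟩
          · exact ⟨⟨hy, hx⟩, fun h => hxy h.symm⟩
    have := graphProb_edges_disjoint_le p (B := B) (fun e he => by
      simpa [allEdges] using (Finset.mem_filter.1 he).2)
    rw [hB] at this
    refine le_trans (graphProb_mono ?_) this
    intro Γ hΓ e he
    induction e with
    | _ a b =>
      obtain ⟨he, -⟩ := Finset.mem_filter.1 he
      rw [Finset.mk_mem_sym2_iff] at he
      exact hΓ a he.1 b he.2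
  · gcongr
    rw [Finset.card_powersetCard]
    exact_mod_cast (Nat.choose_le_two_pow _ _)

end Generic

/-- A vertex of `W` loses few neighbours. -/
lemma graphProb_lossW_le {n : ℕ} {P : Layout (Fin n)} {p : unitInterval} {w : Fin n}
    (hw : w ∈ P.W) {M t : ℝ} (hM0 : 0 ≤ M) :
    graphProb p {Γ | (∀ a, ((nbrIn Γ Finset.univ a).card : ℝ) ≤ M) ∧
      2 * t ≤ ((P.lossW Γ w).card : ℝ)} ≤
      2 * Real.exp (-t + 2 * p * ((2 * P.k) ^ 2 * (P.D * P.D' * M ^ (2 * P.k - 3)) * M)) := by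
  have hwU : w ∉ P.U := fun h => P.notMem_W_of_U w h hw
  have hp0 : (0 : ℝ) ≤ p := p.2.1
  refine le_trans (graphProb_mono ?_) (graphProb_cutStar_nbrIn_le p hwU
    (fun H s => (∀ a, ((nbrIn H Finset.univ a).card : ℝ) ≤ M) ∧ (s.card : ℝ) ≤ M ∧
      2 * t ≤ (({u ∈ s | ∃ v ∈ s, v ≠ u ∧ u ∈ P.reachW H v}).card : ℝ)) fun H => ?_)
  · rintro Γ ⟨hΓ, ht⟩
    rw [Layout.lossW] at ht
    refine ⟨fun a => le_trans (Nat.cast_le.2 (Layout.card_nbrIn_cutStar_le _ _ _ _)) (hΓ a), ?_, by convert ht⟩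
    refine le_trans (Nat.cast_le.2 (Finset.card_le_card fun x hx => ?_)) (hΓ w)
    exact mem_nbrIn.2 ⟨Finset.mem_univ _, (mem_nbrIn.1 hx).2⟩
  -- The degree bound is part of the event: it bounds `reachW H`, and if `H` violates it the
  -- probability is zero.
  · by_cases hH : ∀ a, ((nbrIn H Finset.univ a).card : ℝ) ≤ M
    · refine (bernProb_mono hp0 p.2.2 fun s _ h => h.2).trans ?_
      have key := bernProb_related_le (E := P.U) (M := M) (t := t) hp0 p.2.2 (P.reachW H)
        (by positivity) fun v => Layout.card_reachW_le hM0 hH v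
      refine le_of_eq_of_le ?_ key
      congr!
    · simp only [hH, false_and, bernProb, if_false]
      have := bernExp_const_mul (E := P.U) (p := (p : ℝ)) (f := fun _ => 1) 0
      simp only [zero_mul] at this
      rw [this]
      positivity

end BadEvents

/-! ### Combining the bad events for fixed `n`. -/

section FiniteBound

open scoped Classical

lemma notMem_boundedChromaticEvent {n : ℕ} [NeZero n] {P : Layout (Fin n)} {Γ : SimpleGraph (Fin n)}
    {μ : ℝ} {C s : ℕ} (hdeg : ∀ v, μ ≤ ((nbrIn (P.final Γ) Finset.univ v).card : ℝ))
    (hs : ∀ S ⊆ P.X, S.card = s → ∃ a ∈ S, ∃ b ∈ S, Γ.Adj a b)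
    (hcard : C * s < (P.coreSet Γ).card) :
    Γ ∉ BoundedChromaticEvent (SimpleGraph.cycleGraph (2 * P.k + 1)) n μ C := by
  intro h
  refine Layout.lt_chromaticNumber_final hs hcard
    (h (P.final Γ) (Layout.final_le_base.trans Layout.base_le) Layout.cycleGraph_free_final ?_)
  obtain ⟨v, hv⟩ := (P.final Γ).exists_minimal_degree_vertex
  rw [hv]
  refine (hdeg v).trans (Nat.cast_le.2 ?_)
  rw [← SimpleGraph.card_neighborFinset_eq_degree]
  exact Finset.card_le_card fun b hb => by simpa using hb

/-- The probability that all spanning subgraphs without `2 * k + 1`-cycles and of large minimum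
degree have bounded chromatic number is small, for suitable values of the parameters. -/
lemma graphProb_boundedChromaticEvent_le_half {n : ℕ} [NeZero n] {p : unitInterval}
    (hp : 0 < (p : ℝ)) (P : Layout (Fin n)) {C s : ℕ} {ε θ τ M : ℝ} (hε : 0 < ε) (hε1 : ε ≤ 1 / 2)
    (hθ : 0 < θ) (hτ : 0 < τ) (hM : M = 3 * (p * n)) (hD' : 0 < P.D')
    (hX : 0 < P.X.card)
    (hU : (1 / 2 - ε / 4) * n ≤ P.U.card) (hW : (1 / 2 - ε / 4) * n ≤ P.W.card)
    (hθ1 : P.D' * (2 * θ) ≤ ε / 4) (hθ2 : P.D * (2 * θ) ≤ ε / 8) (hθ3 : 4 * θ ≤ ε / 4)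
    (hτ1 : 2 * τ ≤ ε / 16)
    (hη1 : 2 * (2 * P.k * (P.D * M ^ (2 * P.k - 2))) ≤ θ * n)
    (hη2 : 2 * ((2 * P.k) ^ 2 * (P.D * P.D' * M ^ (2 * P.k - 3)) * M) ≤ θ * n)
    (hη3 : 2 * ((P.D + P.D') * M ^ (2 * P.k - 2)) ≤ θ * n)
    (he1 : n * Real.exp (-(p * n)) ≤ 1 / 100)
    (he2 : n * Real.exp (-(ε ^ 2 / 64 * (p * n))) ≤ 1 / 100)
    (he3 : n ^ 2 * Real.exp (-(θ * (p * n))) ≤ 1 / 100)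
    (he4 : n * Real.exp (-(ε / 16 * (p * n))) ≤ 1 / 100)
    (hheavy : (P.U.card * (P.X.card * p / P.D') / (τ * n) : ℝ) ≤ 1 / 20)
    (hhigh : (P.X.card * (P.X.card * p / (P.D + 1)) / (P.X.card / 4) : ℝ) ≤ 1 / 20)
    (hcyc : (P.X.card * p : ℝ) ^ (2 * P.k + 1) / (P.X.card / 4 : ℝ) ≤ 1 / 20)
    (hind : 2 ^ P.X.card * (1 - (p : ℝ)) ^ (s.choose 2) ≤ 1 / 20)
    (hCs : (C * s : ℝ) ≤ P.X.card / 2) :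
    graphProb p (BoundedChromaticEvent (SimpleGraph.cycleGraph (2 * P.k + 1)) n
      ((1 / 2 - ε) * (p * n)) C) ≤ 1 / 2 := by
  have hn : (0 : ℝ) < n := by exact_mod_cast Nat.pos_of_ne_zero (NeZero.ne n)
  have hn1 : (1 : ℝ) ≤ n := by exact_mod_cast Nat.pos_of_ne_zero (NeZero.ne n)
  have hp1 : (p : ℝ) ≤ 1 := p.2.2
  have hk := P.two_le_k
  have hM0 : 0 ≤ M := by rw [hM]; positivity
  have hθn : (p : ℝ) * (θ * n) = θ * (p * n) := by ring
  have hτn : 2 * (p : ℝ) * (τ * n) = 2 * τ * (p * n) := by ring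
  replace hη1 := mul_le_mul_of_nonneg_left hη1 hp.le
  replace hη2 := mul_le_mul_of_nonneg_left hη2 hp.le
  replace hη3 := mul_le_mul_of_nonneg_left hη3 hp.le
  rw [hθn] at hη1 hη2 hη3
  obtain ⟨a, ha⟩ : ∃ a : ℝ, a = p * n := ⟨_, rfl⟩
  rw [← ha] at hM hη1 hη2 hη3 he1 he2 he3 he4 hτn
  rw [← ha]
  have ha0 : 0 < a := by rw [ha]; positivity
  have hXc : (0 : ℝ) < P.X.card := by exact_mod_cast hX
  have hcardle : ∀ A : Finset (Fin n), (A.card : ℝ) ≤ n := fun A => by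
    exact_mod_cast (Finset.card_le_univ A).trans_eq (Fintype.card_fin n)
  let side : Fin n → Finset (Fin n) := fun v => if v ∈ P.U then P.W else P.U
  have hside : ∀ v, v ∉ side v := fun v => by
    simp only [side]
    split_ifs with h
    · exact P.notMem_W_of_U v h
    · exact h
  have hsidec : ∀ v, (1 / 2 - ε / 4) * n ≤ ((side v).card : ℝ) := fun v => by
    simp only [side]
    split_ifs
    · exact hW
    · exact hU
  obtain ⟨τU, hτU⟩ : ∃ t : ℝ, t = 2 * P.k * (P.D * M ^ (2 * P.k - 2)) := ⟨_, rfl⟩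
  obtain ⟨τX, hτX⟩ : ∃ t : ℝ, t = (P.D + P.D') * M ^ (2 * P.k - 2) := ⟨_, rfl⟩
  rw [← hτU] at hη1
  rw [← hτX] at hη3
  -- `B1` and `B2` control degrees in the random graph, `B3`, `B4`, `B5` the cuts at `U`, `W`, `X`,
  -- `B6` and `B7` the heavy vertices, and `B8`, `B9`, `B10` the chromatic number of the core.
  let B1 : Set (SimpleGraph (Fin n)) := {Γ | ∃ v ∈ (Finset.univ : Finset (Fin n)),
    3 * a ≤ ((nbrIn Γ Finset.univ v).card : ℝ)}
  let B2 : Set (SimpleGraph (Fin n)) := {Γ | ∃ v ∈ (Finset.univ : Finset (Fin n)),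
    ((nbrIn Γ (side v) v).card : ℝ) ≤ (1 - ε / 2) * (p * (side v).card)}
  let B3 : Set (SimpleGraph (Fin n)) := {Γ | ∃ q ∈ P.U ×ˢ P.X,
    ((P.reachU (cutStar Γ P.W q.1) q.2).card : ℝ) ≤ τU ∧
      2 * θ * a ≤ ((nbrIn Γ P.W q.1 ∩ P.reachU (cutStar Γ P.W q.1) q.2).card : ℝ)}
  let B4 : Set (SimpleGraph (Fin n)) := {Γ | ∃ w ∈ P.W,
    (∀ v, ((nbrIn Γ Finset.univ v).card : ℝ) ≤ M) ∧
      2 * (2 * θ * a) ≤ ((P.lossW Γ w).card : ℝ)}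
  let B5 : Set (SimpleGraph (Fin n)) := {Γ | ∃ q ∈ P.X ×ˢ P.X,
    ((P.reachX (cutStar Γ P.U q.1) q.2).card : ℝ) ≤ τX ∧
      2 * θ * a ≤ ((nbrIn Γ P.U q.1 ∩ P.reachX (cutStar Γ P.U q.1) q.2).card : ℝ)}
  let B6 : Set (SimpleGraph (Fin n)) := {Γ | τ * n ≤ ((P.heavy Γ).card : ℝ)}
  let B7 : Set (SimpleGraph (Fin n)) := {Γ | ∃ x ∈ P.X,
    ((P.heavy (cutStar Γ P.U x)).card : ℝ) ≤ τ * n ∧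
      ε / 8 * a ≤ ((nbrIn Γ P.U x ∩ P.heavy (cutStar Γ P.U x)).card : ℝ)}
  let B8 : Set (SimpleGraph (Fin n)) := {Γ | ∃ S ∈ P.X.powersetCard s,
    ∀ a ∈ S, ∀ b ∈ S, ¬ Γ.Adj a b}
  let B9 : Set (SimpleGraph (Fin n)) := {Γ | (P.X.card / 4 : ℝ) ≤
    (({x ∈ P.X | P.D + 1 ≤ (nbrIn Γ P.X x).card}).card : ℝ)}
  let B10 : Set (SimpleGraph (Fin n)) := {Γ | (P.X.card / 4 : ℝ) ≤
    (({x ∈ P.X | ∃ c, IsCyc Γ (2 * P.k + 1) c ∧ (∀ i, c i ∈ P.X) ∧ c 0 = x}).card : ℝ)}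
  have b1 : graphProb p B1 ≤ 1 / 100 := by
    have := graphProb_maxDegree_le (V := Fin n) (p := p) (n := (n : ℝ)) (by simp)
    rw [← ha] at this
    exact this.trans he1
  have b2 : graphProb p B2 ≤ 1 / 100 := by
    refine (graphProb_exists_le_of_le (δ := Real.exp (-(ε ^ 2 / 64 * a))) _ _ fun v _ =>
      (graphProb_nbrIn_small_le (hside v) (by linarith) (by linarith)).trans ?_).trans ?_
    · rw [Real.exp_le_exp]
      have h1 : n / 4 ≤ ((side v).card : ℝ) := by
        have : 1 / 4 * (n : ℝ) ≤ (1 / 2 - ε / 4) * n :=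
          mul_le_mul_of_nonneg_right (by linarith) hn.le
        linarith [hsidec v]
      have h2 : a / 4 ≤ p * ((side v).card : ℝ) := by
        rw [ha, mul_div_assoc]
        exact mul_le_mul_of_nonneg_left h1 hp.le
      linarith [mul_le_mul_of_nonneg_left h2 (by positivity : 0 ≤ (ε / 2) ^ 2 / 4)]
    · simpa using he2
  have b3 : graphProb p B3 ≤ 1 / 100 := by
    refine (graphProb_exists_le_of_le (δ := Real.exp (-(θ * a))) _ _ fun q hq =>
      (graphProb_card_nbrIn_inter_ge_le (P.notMem_W_of_U _ (Finset.mem_product.1 hq).1)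
        (fun H => P.reachU H q.2)).trans ?_).trans ?_
    · rw [Real.exp_le_exp]
      linarith
    · refine le_trans (mul_le_mul_of_nonneg_right ?_ (Real.exp_pos _).le) he3
      rw [Finset.card_product]
      push_cast
      rw [sq]
      exact mul_le_mul (hcardle _) (hcardle _) hXc.le hn.le
  have b4 : graphProb p B4 ≤ 2 / 100 := by
    refine (graphProb_exists_le_of_le (δ := 2 * Real.exp (-(θ * a))) _ _ fun w hw =>
      (graphProb_lossW_le hw hM0).trans ?_).trans ?_
    · gcongr
      linarith
    · have h1 : (P.W.card : ℝ) ≤ n ^ 2 := (hcardle _).trans (by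
        rw [sq]; exact le_mul_of_one_le_left hn.le hn1)
      have := mul_le_mul_of_nonneg_right h1 (Real.exp_pos (-(θ * a))).le
      linarith
  have b5 : graphProb p B5 ≤ 1 / 100 := by
    refine (graphProb_exists_le_of_le (δ := Real.exp (-(θ * a))) _ _ fun q hq =>
      (graphProb_card_nbrIn_inter_ge_le (P.notMem_U_of_X _ (Finset.mem_product.1 hq).1)
        (fun H => P.reachX H q.2)).trans ?_).trans ?_
    · rw [Real.exp_le_exp]
      linarith
    · refine le_trans (mul_le_mul_of_nonneg_right ?_ (Real.exp_pos _).le) he3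
      rw [Finset.card_product]
      push_cast
      rw [sq]
      exact mul_le_mul (hcardle _) (hcardle _) hXc.le hn.le
  have b6 : graphProb p B6 ≤ 1 / 20 := (graphProb_heavy_le (by positivity) hD').trans hheavy
  have b7 : graphProb p B7 ≤ 1 / 100 := by
    refine (graphProb_exists_le_of_le (δ := Real.exp (-(ε / 16 * a))) _ _ fun x hx =>
      (graphProb_card_nbrIn_inter_ge_le (P.notMem_U_of_X _ hx)
        (fun H => P.heavy H)).trans ?_).trans ?_
    · rw [Real.exp_le_exp]
      rw [hτn]
      linarith [mul_le_mul_of_nonneg_right hτ1 ha0.le]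
    · exact le_trans (mul_le_mul_of_nonneg_right (hcardle _) (Real.exp_pos _).le) he4
  have b8 : graphProb p B8 ≤ 1 / 20 := (graphProb_indep_le P.X s).trans hind
  have b9 : graphProb p B9 ≤ 1 / 20 := (graphProb_high_degree_le (by positivity)).trans hhigh
  have b10 : graphProb p B10 ≤ 1 / 20 :=
    (graphProb_cycles_le (by omega) P.X (by positivity)).trans hcyc
  have hsub : BoundedChromaticEvent (SimpleGraph.cycleGraph (2 * P.k + 1)) n
      ((1 / 2 - ε) * a) C ⊆
      B1 ∪ (B2 ∪ (B3 ∪ (B4 ∪ (B5 ∪ (B6 ∪ (B7 ∪ (B8 ∪ (B9 ∪ B10)))))))) := by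
    intro Γ hΓ
    by_contra hcon
    simp only [Set.mem_union, not_or] at hcon
    obtain ⟨n1, n2, n3, n4, n5, n6, n7, n8, n9, n10⟩ := hcon
    simp only [B1, B2, B3, B4, B5, B6, B7, B8, B9, B10, Set.mem_ofPred_eq, not_exists, not_and,
      not_le, Finset.mem_univ, true_implies, Finset.mem_product, and_imp, Prod.forall]
      at n1 n2 n3 n4 n5 n6 n7 n8 n9 n10
    have hmax : ∀ v, ((nbrIn Γ Finset.univ v).card : ℝ) ≤ M := fun v => by
      rw [hM]; exact (n1 v).le
    have hmaxcut : ∀ A b v, ((nbrIn (cutStar Γ A b) Finset.univ v).card : ℝ) ≤ M := fun A b v =>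
      le_trans (Nat.cast_le.2 (Layout.card_nbrIn_cutStar_le _ _ _ _)) (hmax v)
    have hlow : ∀ v, (1 / 2 - ε / 2) * a ≤ ((nbrIn Γ (side v) v).card : ℝ) := fun v => by
      refine le_trans ?_ (n2 v).le
      have h1 : (1 / 2 - ε / 4) * a ≤ p * ((side v).card : ℝ) := by
        refine le_of_eq_of_le ?_ (mul_le_mul_of_nonneg_left (hsidec v) hp.le)
        rw [ha]; ring
      have h2 : 0 ≤ 1 - ε / 2 := by linarith
      refine le_trans ?_ (mul_le_mul_of_nonneg_left h1 h2)
      rw [← mul_assoc]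
      refine mul_le_mul_of_nonneg_right ?_ ha0.le
      have := mul_pos hε hε
      linarith
    have hθa : 0 ≤ 2 * θ * a := by positivity
    refine notMem_boundedChromaticEvent (P := P) (s := s) (fun v => ?_) (fun S hS hSs => ?_) ?_ hΓ
    -- Each vertex starts with at least `(1/2 - ε/2) * a` edges and loses at most `ε/4 * a`; in `X`,
    -- the cuts and the heavy vertices take at most `ε/8 * a` each.
    · have hv := hlow v
      rcases P.cover v with h | h | h
      · simp only [side, if_neg (P.notMem_U_of_X v h)] at hv
        have := Layout.card_nbrIn_le_of_mem_X h hθa fun y hy =>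
          (n5 v y h hy (hτX ▸ Layout.card_reachX_le hM0 (hmaxcut _ _) y)).le
        have h7 := n7 v h (le_trans (Nat.cast_le.2 (Finset.card_le_card
          (Layout.heavy_cutStar_subset _ _))) n6.le)
        linarith [mul_le_mul_of_nonneg_right hθ2 ha0.le, mul_pos hε ha0]
      · simp only [side, if_pos h] at hv
        have := Layout.card_nbrIn_le_of_mem_U h hθa fun y hy =>
          (n3 v y h hy (hτU ▸ Layout.card_reachU_le hM0 (hmaxcut _ _) y)).le
        linarith [mul_le_mul_of_nonneg_right hθ1 ha0.le, mul_pos hε ha0]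
      · simp only [side, if_neg (fun h' => P.notMem_W_of_U v h' h)] at hv
        have := Layout.card_nbrIn_le_of_mem_W (Γ := Γ) h
        have h4 := n4 v h hmax
        linarith [mul_le_mul_of_nonneg_right hθ3 ha0.le, mul_pos hε ha0]
    · by_contra! hcon
      exact n8 S (Finset.mem_powersetCard.2 ⟨hS, hSs⟩) hcon
    · have := Layout.card_coreSet_ge (P := P) (Γ := Γ)
      have h1 : (C * s : ℝ) < (P.coreSet Γ).card := by linarith
      exact_mod_cast h1
  -- The ten bounds add up to 27/100.
  refine (graphProb_mono hsub).trans ?_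
  have u1 := graphProb_union_le (p := p) B1 (B2 ∪ (B3 ∪ (B4 ∪ (B5 ∪ (B6 ∪ (B7 ∪ (B8 ∪ (B9 ∪ B10))))))))
  have u2 := graphProb_union_le (p := p) B2 (B3 ∪ (B4 ∪ (B5 ∪ (B6 ∪ (B7 ∪ (B8 ∪ (B9 ∪ B10)))))))
  have u3 := graphProb_union_le (p := p) B3 (B4 ∪ (B5 ∪ (B6 ∪ (B7 ∪ (B8 ∪ (B9 ∪ B10))))))
  have u4 := graphProb_union_le (p := p) B4 (B5 ∪ (B6 ∪ (B7 ∪ (B8 ∪ (B9 ∪ B10)))))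
  have u5 := graphProb_union_le (p := p) B5 (B6 ∪ (B7 ∪ (B8 ∪ (B9 ∪ B10))))
  have u6 := graphProb_union_le (p := p) B6 (B7 ∪ (B8 ∪ (B9 ∪ B10)))
  have u7 := graphProb_union_le (p := p) B7 (B8 ∪ (B9 ∪ B10))
  have u8 := graphProb_union_le (p := p) B8 (B9 ∪ B10)
  have u9 := graphProb_union_le (p := p) B9 B10
  linarith

end FiniteBound

/-! ### Consequences of the two bounds on `p`, and choice of the partition. -/

section Asymptotics

variable {p : ℕ → unitInterval}

lemma eventually_log_sq_le
    (hlower : ∀ᶠ n : ℕ in atTop, (Real.log (n : ℝ)) ^ 2 / (n : ℝ) ≤ (p n : ℝ)) :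
    ∀ᶠ n : ℕ in atTop, (Real.log (n : ℝ)) ^ 2 ≤ (p n : ℝ) * n := by
  filter_upwards [hlower, eventually_gt_atTop 0] with n h hn
  have hn' : (0 : ℝ) < n := by exact_mod_cast hn
  exact (div_le_iff₀ hn').1 h

lemma tendsto_log_natCast_atTop : Tendsto (fun n : ℕ => Real.log (n : ℝ)) atTop atTop :=
  Real.tendsto_log_atTop.comp tendsto_natCast_atTop_atTop

lemma tendsto_mul_natCast_atTop
    (hlower : ∀ᶠ n : ℕ in atTop, (Real.log (n : ℝ)) ^ 2 / (n : ℝ) ≤ (p n : ℝ)) :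
    Tendsto (fun n : ℕ => (p n : ℝ) * n) atTop atTop := by
  refine tendsto_atTop_mono' atTop (eventually_log_sq_le hlower) ?_
  exact (tendsto_pow_atTop (two_ne_zero)).comp tendsto_log_natCast_atTop

/-- Since `p * n ≥ (log n) ^ 2`, the exponential is at most `n ^ (-3)` once `κ * log n ≥ 3`, however
small `κ` is. -/
lemma eventually_sq_mul_exp_le
    (hlower : ∀ᶠ n : ℕ in atTop, (Real.log (n : ℝ)) ^ 2 / (n : ℝ) ≤ (p n : ℝ)) {κ : ℝ} (hκ : 0 < κ) :
    ∀ᶠ n : ℕ in atTop, (n : ℝ) ^ 2 * Real.exp (-(κ * ((p n : ℝ) * n))) ≤ 1 / 100 := by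
  filter_upwards [eventually_log_sq_le hlower, eventually_ge_atTop 100,
    tendsto_log_natCast_atTop.eventually_ge_atTop (3 / κ)] with n h hn hlog
  have hn' : (100 : ℝ) ≤ n := by exact_mod_cast hn
  have hn0 : (0 : ℝ) < n := by linarith
  have hl0 : 0 ≤ Real.log n := Real.log_nonneg (by linarith)
  have h1 : 3 ≤ κ * Real.log n := by
    rw [div_le_iff₀ hκ] at hlog
    linarith
  have h2 : 3 * Real.log n ≤ κ * ((p n : ℝ) * n) := by
    calc 3 * Real.log n ≤ κ * Real.log n * Real.log n := by gcongr
      _ = κ * Real.log n ^ 2 := by ring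
      _ ≤ _ := by gcongr
  have h3 : Real.exp (-(κ * ((p n : ℝ) * n))) ≤ ((n : ℝ) ^ 3)⁻¹ := by
    rw [Real.exp_neg]
    refine inv_anti₀ (by positivity) ?_
    calc (n : ℝ) ^ 3 = Real.exp (3 * Real.log n) := by
          rw [show (3 : ℝ) * Real.log n = ((3 : ℕ) : ℝ) * Real.log n by norm_num,
            Real.exp_nat_mul, Real.exp_log hn0]
      _ ≤ _ := Real.exp_le_exp.2 h2
  calc (n : ℝ) ^ 2 * Real.exp (-(κ * ((p n : ℝ) * n))) ≤ (n : ℝ) ^ 2 * ((n : ℝ) ^ 3)⁻¹ := by gcongr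
    _ = 1 / (n : ℝ) := by field_simp
    _ ≤ 1 / 100 := by gcongr

variable {k : ℕ}

/-- Multiplied by `n`, the upper bound on `p` reads `p * n = o(n ^ (1 / (2k - 2)))`. -/
lemma eventually_pow_le (hk : 2 ≤ k) (hupper : (fun n : ℕ => (p n : ℝ)) =o[atTop]
      (fun n : ℕ => (n : ℝ) ^ (-((2 * (k : ℝ) - 3) / (2 * (k : ℝ) - 2))))) {η : ℝ} (hη : 0 < η) :
    ∀ᶠ n : ℕ in atTop, ((p n : ℝ) * n) ^ (2 * k - 2) ≤ η * n := by
  -- A constant at most 1 only shrinks when raised to the power `2 * k - 2`.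
  have hc : 0 < min 1 η := lt_min one_pos hη
  filter_upwards [isLittleO_iff.1 hupper hc, eventually_gt_atTop 0] with n h hn
  have hn' : (0 : ℝ) < n := by exact_mod_cast hn
  have hp : (0 : ℝ) ≤ p n := (p n).2.1
  rw [Real.norm_of_nonneg hp, Real.norm_of_nonneg (Real.rpow_nonneg hn'.le _)] at h
  have hN : 2 * k - 2 ≠ 0 := by omega
  have hNr : ((2 * k - 2 : ℕ) : ℝ) = 2 * (k : ℝ) - 2 := by
    rw [Nat.cast_sub (by omega)]; push_cast; ring
  have hk' : (2 : ℝ) ≤ k := by exact_mod_cast hk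
  have h1 : (p n : ℝ) * n ≤ min 1 η * (n : ℝ) ^ (((2 * k - 2 : ℕ) : ℝ)⁻¹) := by
    calc (p n : ℝ) * n
        ≤ min 1 η * (n : ℝ) ^ (-((2 * (k : ℝ) - 3) / (2 * (k : ℝ) - 2))) * n := by gcongr
      _ = min 1 η * ((n : ℝ) ^ (-((2 * (k : ℝ) - 3) / (2 * (k : ℝ) - 2))) * (n : ℝ) ^ (1 : ℝ)) := by
          rw [Real.rpow_one, mul_assoc]
      _ = _ := by
          rw [← Real.rpow_add hn', hNr]
          congr 2
          have : 2 * (k : ℝ) - 2 ≠ 0 := by linarith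
          have e : (2 * (k : ℝ) - 3) / (2 * (k : ℝ) - 2) = 1 - (2 * (k : ℝ) - 2)⁻¹ := by
            rw [eq_sub_iff_add_eq, ← one_div, ← add_div, div_eq_one_iff_eq this]
            ring
          rw [e]
          ring
  calc ((p n : ℝ) * n) ^ (2 * k - 2)
      ≤ (min 1 η * (n : ℝ) ^ (((2 * k - 2 : ℕ) : ℝ)⁻¹)) ^ (2 * k - 2) := by gcongr
    _ = (min 1 η) ^ (2 * k - 2) * n := by
        rw [mul_pow, Real.rpow_inv_natCast_pow hn'.le hN]
    _ ≤ min 1 η * n := by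
        gcongr
        exact pow_le_of_le_one hc.le (min_le_left _ _) hN
    _ ≤ η * n := by gcongr; exact min_le_right _ _

lemma eventually_le_const (hk : 2 ≤ k) (hupper : (fun n : ℕ => (p n : ℝ)) =o[atTop]
      (fun n : ℕ => (n : ℝ) ^ (-((2 * (k : ℝ) - 3) / (2 * (k : ℝ) - 2))))) {ρ : ℝ} (hρ : 0 < ρ) :
    ∀ᶠ n : ℕ in atTop, (p n : ℝ) ≤ ρ := by
  have hk' : (2 : ℝ) ≤ k := by exact_mod_cast hk
  have h1 : Tendsto (fun n : ℕ => (n : ℝ) ^ (-((2 * (k : ℝ) - 3) / (2 * (k : ℝ) - 2)))) atTop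
      (𝓝 0) := (tendsto_rpow_neg_atTop (div_pos (by linarith) (by linarith))).comp
        tendsto_natCast_atTop_atTop
  have h2 := hupper.trans_tendsto h1
  filter_upwards [h2.eventually (gt_mem_nhds hρ)] with n hn using hn.le

/-- The estimate that makes large independent sets unlikely. -/
lemma two_pow_mul_one_sub_pow_choose_le {p : ℝ} (hp0 : 0 ≤ p) (hp1 : p ≤ 1) {C m s : ℕ} (hC : 0 < C)
    (hm : 20 ≤ m) (hs : 2 ≤ s) (hsm : (m : ℝ) ≤ 4 * C * s) (hpm : 128 * (C : ℝ) ^ 2 ≤ p * m) :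
    2 ^ m * (1 - p) ^ (s.choose 2) ≤ 1 / 20 := by
  have hs' : (2 : ℝ) ≤ s := by exact_mod_cast hs
  have hm' : (20 : ℝ) ≤ m := by exact_mod_cast hm
  have hC' : (0 : ℝ) < C := by exact_mod_cast hC
  have h1 : (s : ℝ) ^ 2 / 4 ≤ (s.choose 2 : ℝ) := by
    rw [Nat.cast_choose_two]
    nlinarith
  -- Indeed `p * s ^ 2 / 4 ≥ (p * m) * m / (64 * C ^ 2) ≥ 2 * m`, which explains the constant 128
  -- and beats the factor `2 ^ m ≤ exp m`.
  have h2 : (2 : ℝ) * m ≤ p * (s.choose 2 : ℝ) := by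
    have h3 : (m : ℝ) ^ 2 ≤ (4 * C * s) ^ 2 := by gcongr
    have h4 : (m : ℝ) ^ 2 ≤ 64 * (C : ℝ) ^ 2 * (s.choose 2 : ℝ) := by nlinarith [sq_nonneg (C : ℝ)]
    have h5 : 128 * (C : ℝ) ^ 2 * m ≤ p * m * m := by gcongr
    have h6 : p * m * m ≤ p * (64 * (C : ℝ) ^ 2 * (s.choose 2 : ℝ)) := by
      rw [mul_assoc, ← sq]
      gcongr
    have h7 : 64 * (C : ℝ) ^ 2 * (2 * m) ≤ 64 * (C : ℝ) ^ 2 * (p * (s.choose 2 : ℝ)) := by linarith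
    exact le_of_mul_le_mul_left h7 (by positivity)
  have h8 : (1 - p) ^ (s.choose 2) ≤ Real.exp (-(2 * m)) := by
    calc (1 - p) ^ (s.choose 2) ≤ Real.exp (-p) ^ (s.choose 2) := by
          gcongr
          linarith [Real.add_one_le_exp (-p)]
      _ = Real.exp (-(p * (s.choose 2 : ℝ))) := by
          rw [← Real.exp_nat_mul]; ring_nf
      _ ≤ _ := by rw [Real.exp_le_exp]; linarith
  have h9 : (2 : ℝ) ^ m ≤ Real.exp m := by
    calc (2 : ℝ) ^ m ≤ Real.exp 1 ^ m := by
          gcongr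
          linarith [Real.add_one_le_exp (1 : ℝ)]
      _ = Real.exp m := by rw [← Real.exp_nat_mul, mul_one]
  calc (2 : ℝ) ^ m * (1 - p) ^ (s.choose 2) ≤ Real.exp m * Real.exp (-(2 * m)) := by gcongr
    _ = (Real.exp m)⁻¹ := by rw [← Real.exp_add, ← Real.exp_neg]; ring_nf
    _ ≤ (20 : ℝ)⁻¹ := by
        refine inv_anti₀ (by norm_num) ?_
        linarith [Real.add_one_le_exp (m : ℝ)]
    _ = 1 / 20 := by norm_num

lemma exists_layout {n m : ℕ} (hm : m ≤ n) (hk : 2 ≤ k) (D D' : ℕ) :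
    ∃ P : Layout (Fin n), P.k = k ∧ P.D = D ∧ P.D' = D' ∧ P.X.card = m ∧
      P.U.card = (n - m) / 2 ∧ P.W.card = (n - m) - (n - m) / 2 := by
  obtain ⟨X, -, hX⟩ := Finset.exists_subset_card_eq (s := (Finset.univ : Finset (Fin n))) (n := m)
    (by simpa using hm)
  have hXc : Xᶜ.card = n - m := by rw [Finset.card_compl, hX, Fintype.card_fin]
  obtain ⟨U, hUX, hU⟩ := Finset.exists_subset_card_eq (s := Xᶜ) (n := (n - m) / 2) (by omega)
  refine ⟨⟨X, U, Xᶜ \ U, fun v hv hvU => ?_, fun v hv => by simp [hv], fun v hv => by simp [hv],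
    fun v => ?_, k, hk, D, D'⟩, rfl, rfl, rfl, hX, hU, ?_⟩
  · exact Finset.mem_compl.1 (hUX hvU) hv
  · by_cases h1 : v ∈ X
    · exact Or.inl h1
    · by_cases h2 : v ∈ U
      · exact Or.inr (Or.inl h2)
      · exact Or.inr (Or.inr (by simp [h1, h2]))
  · rw [Finset.card_sdiff_of_subset hUX, hXc, hU]

end Asymptotics

/-! ### Choice of the parameters and conclusion. -/

section Main

variable {k : ℕ} {p : ℕ → unitInterval}

set_option maxHeartbeats 1000000 in
/-- Below minimum degree `p * n / 2`, the chromatic number is not bounded asymptotically almost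
surely. -/
lemma eventually_graphProb_le_half (hk : 2 ≤ k)
    (hlower : ∀ᶠ n : ℕ in atTop, (Real.log (n : ℝ)) ^ 2 / (n : ℝ) ≤ (p n : ℝ))
    (hupper : (fun n : ℕ => (p n : ℝ)) =o[atTop]
      (fun n : ℕ => (n : ℝ) ^ (-((2 * (k : ℝ) - 3) / (2 * (k : ℝ) - 2)))))
    {d : ℝ} (hd0 : 0 < d) (hd : d < 1 / 2) {C : ℕ} (hC : 0 < C) :
    ∀ᶠ n : ℕ in atTop, graphProb (p n)
      (BoundedChromaticEvent (SimpleGraph.cycleGraph (2 * k + 1)) n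
        (d * (p n : ℝ) * (n : ℝ)) C) ≤ 1 / 2 := by
  obtain ⟨ε, hε⟩ : ∃ ε : ℝ, ε = 1 / 2 - d := ⟨_, rfl⟩
  have hε0 : 0 < ε := by linarith
  have hε1 : ε ≤ 1 / 2 := by linarith
  have hC1 : (1 : ℝ) ≤ C := by exact_mod_cast hC
  obtain ⟨K, hK⟩ : ∃ K : ℕ, K = 128 * C ^ 2 := ⟨_, rfl⟩
  have hK1 : (1 : ℝ) ≤ K := by rw [hK]; push_cast; nlinarith
  -- Expected degrees into `X` are at most `K + 1`. The choices of `D` and `D'` make Markov's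
  -- inequality give 1/20 for `|X| / 4` vertices of high degree and for `τ * n` heavy vertices.
  obtain ⟨D, hD⟩ : ∃ D : ℕ, D = 80 * (K + 1) := ⟨_, rfl⟩
  obtain ⟨τ, hτ⟩ : ∃ τ : ℝ, τ = ε / 32 := ⟨_, rfl⟩
  have hτ0 : 0 < τ := by rw [hτ]; positivity
  obtain ⟨D', hD'⟩ : ∃ D' : ℕ, D' = ⌈20 * ((K : ℝ) + 1) / τ⌉₊ + 1 := ⟨_, rfl⟩
  have hD'0 : 0 < D' := by omega
  have hD'r : 20 * ((K : ℝ) + 1) / τ ≤ D' := by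
    rw [hD']; push_cast; linarith [Nat.le_ceil (20 * ((K : ℝ) + 1) / τ)]
  obtain ⟨θ, hθ⟩ : ∃ θ : ℝ, θ = ε / (32 * (((D : ℝ) + 1) * (D' + 1))) := ⟨_, rfl⟩
  have hθ0 : 0 < θ := by rw [hθ]; positivity
  have hθm : 32 * (((D : ℝ) + 1) * (D' + 1)) * θ = ε := by rw [hθ]; field_simp
  have hDD : (D : ℝ) ≤ ((D : ℝ) + 1) * (D' + 1) ∧ (D' : ℝ) ≤ ((D : ℝ) + 1) * (D' + 1) ∧
      (1 : ℝ) ≤ ((D : ℝ) + 1) * (D' + 1) ∧ (D : ℝ) * D' ≤ ((D : ℝ) + 1) * (D' + 1) ∧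
      (D : ℝ) + D' ≤ ((D : ℝ) + 1) * (D' + 1) := by
    have h1 : (0 : ℝ) ≤ D := Nat.cast_nonneg _
    have h2 : (0 : ℝ) ≤ D' := Nat.cast_nonneg _
    have h3 := mul_nonneg h1 h2
    refine ⟨?_, ?_, ?_, ?_, ?_⟩ <;> linarith
  obtain ⟨Z, hZ⟩ : ∃ Z : ℝ, Z = ((D : ℝ) + 1) * (D' + 1) := ⟨_, rfl⟩
  rw [← hZ] at hDD hθm
  obtain ⟨z1, z2, z3, z4, z5⟩ := hDD
  have hθ1 : D' * (2 * θ) ≤ ε / 4 := by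
    linarith only [hθm, hε0, mul_le_mul_of_nonneg_right z2 hθ0.le]
  have hθ2 : D * (2 * θ) ≤ ε / 8 := by
    linarith only [hθm, hε0, mul_le_mul_of_nonneg_right z1 hθ0.le]
  have hθ3 : 4 * θ ≤ ε / 4 := by
    linarith only [hθm, hε0, mul_le_mul_of_nonneg_right z3 hθ0.le]
  have hk1 : (2 : ℝ) ≤ k := by exact_mod_cast hk
  obtain ⟨Q, hQ⟩ : ∃ Q : ℝ, Q = 2 * ((2 * k) ^ 2 * Z) * 3 ^ (2 * k - 2) := ⟨_, rfl⟩
  have hQ0 : 0 < Q := by rw [hQ]; positivity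
  -- A lower bound for `|X|`: the first term makes the bounded expected number of cycles negligible
  -- against `|X| / 4`, the second absorbs the rounding of `s`.
  obtain ⟨R, hR⟩ : ∃ R : ℕ, R = 80 * (K + 1) ^ (2 * k + 1) + 8 * C := ⟨_, rfl⟩
  have hR0 : (0 : ℝ) < R := by
    have : 0 < R := by omega
    exact_mod_cast this
  filter_upwards [eventually_sq_mul_exp_le hlower one_pos,
    eventually_sq_mul_exp_le hlower (show 0 < ε ^ 2 / 64 by positivity),
    eventually_sq_mul_exp_le hlower hθ0,
    eventually_sq_mul_exp_le hlower (show 0 < ε / 16 by positivity),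
    eventually_pow_le hk hupper (show 0 < θ / Q by positivity),
    eventually_le_const hk hupper (show 0 < 1 / (R : ℝ) by positivity),
    (tendsto_mul_natCast_atTop hlower).eventually_ge_atTop (2 * (K + 2) / ε),
    eventually_gt_atTop 0] with n e1 e2 e3 e4 hpow hpR hpn hn0
  have : NeZero n := ⟨hn0.ne'⟩
  have hn : (0 : ℝ) < n := by exact_mod_cast hn0
  have hn1 : (1 : ℝ) ≤ n := by exact_mod_cast hn0
  have hnsq : ∀ x : ℝ, (n : ℝ) ^ 2 * Real.exp x ≤ 1 / 100 → n * Real.exp x ≤ 1 / 100 :=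
    fun x hx => le_trans (mul_le_mul_of_nonneg_right (le_self_pow₀ hn1 two_ne_zero)
      (Real.exp_pos _).le) hx
  obtain ⟨q, hq⟩ : ∃ q : ℝ, q = (p n : ℝ) := ⟨_, rfl⟩
  have hq1 : q ≤ 1 := hq ▸ (p n).2.2
  rw [← hq] at e1 e2 e3 e4 hpow hpR hpn
  have hq0 : 0 < q := by
    have h1 : 0 < q * n := lt_of_lt_of_le (by positivity) hpn
    exact pos_of_mul_pos_left h1 hn.le
  obtain ⟨m, hm⟩ : ∃ m : ℕ, m = ⌈(K : ℝ) / q⌉₊ := ⟨_, rfl⟩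
  have hm1 : (K : ℝ) / q ≤ m := hm ▸ Nat.le_ceil _
  have hm2 : (m : ℝ) ≤ (K : ℝ) / q + 1 := hm ▸ (Nat.ceil_lt_add_one (by positivity)).le
  have hmq1 : (K : ℝ) ≤ m * q := (div_le_iff₀ hq0).1 hm1
  have hmq2 : m * q ≤ K + 1 := by
    have := mul_le_mul_of_nonneg_right hm2 hq0.le
    rw [add_mul, div_mul_cancel₀ _ hq0.ne'] at this
    linarith
  have hmR : (R : ℝ) ≤ m := by
    have h1 : q * R ≤ 1 := by rwa [le_div_iff₀ hR0] at hpR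
    have h2 : (R : ℝ) * q ≤ m * q := by linarith
    exact le_of_mul_le_mul_right h2 hq0
  have hmRn : R ≤ m := by exact_mod_cast hmR
  -- `X` takes so few vertices that, even after rounding, `U` and `W` keep `(1/2 - ε/4) * n` each.
  have hmn : (m : ℝ) + 1 ≤ ε / 2 * n := by
    have h1 : (K + 2 : ℝ) ≤ ε / 2 * n * q := by
      rw [div_le_iff₀ hε0] at hpn
      linarith
    have h2 : ((m : ℝ) + 1) * q ≤ ε / 2 * n * q := by linarith
    exact le_of_mul_le_mul_right h2 hq0
  have hmle : m ≤ n := by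
    have h2 : ε / 2 * n ≤ 1 * n := mul_le_mul_of_nonneg_right (by linarith only [hε1]) hn.le
    have h1 : (m : ℝ) ≤ n := by linarith only [h2, hmn]
    exact_mod_cast h1
  obtain ⟨P, hPk, hPD, hPD', hPX, hPU, hPW⟩ := exists_layout hmle hk D D'
  obtain ⟨s, hs⟩ : ∃ s : ℕ, s = ⌈(m : ℝ) / (4 * C)⌉₊ := ⟨_, rfl⟩
  have hCpos : (0 : ℝ) < 4 * C := by linarith
  have hs1 : (m : ℝ) ≤ 4 * C * s := by
    have : (m : ℝ) / (4 * C) ≤ s := hs ▸ Nat.le_ceil _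
    rw [div_le_iff₀ hCpos] at this
    linarith
  have hs2 : (s : ℝ) ≤ m / (4 * C) + 1 := hs ▸ (Nat.ceil_lt_add_one (by positivity)).le
  have hm8 : (8 * C : ℝ) ≤ m := by
    have : 8 * C ≤ m := by omega
    exact_mod_cast this
  have hsge : 2 ≤ s := by
    have h1 : (4 * C : ℝ) * 2 ≤ 4 * C * s := by linarith
    have h2 := le_of_mul_le_mul_left h1 hCpos
    exact_mod_cast h2
  have hCs : (C * s : ℝ) ≤ m / 2 := by
    have h1 : 4 * C * (s : ℝ) ≤ m + 4 * C := by
      have := mul_le_mul_of_nonneg_left hs2 hCpos.le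
      rwa [mul_add, mul_one, mul_div_cancel₀ _ hCpos.ne'] at this
    linarith
  have hcast : ((n - m : ℕ) : ℝ) = n - m := Nat.cast_sub hmle
  have hUr : (1 / 2 - ε / 4) * n ≤ (((n - m) / 2 : ℕ) : ℝ) := by
    have h1 : n - m ≤ 2 * ((n - m) / 2) + 1 := by omega
    have h2 : ((n - m : ℕ) : ℝ) ≤ 2 * (((n - m) / 2 : ℕ) : ℝ) + 1 := by exact_mod_cast h1
    rw [hcast] at h2
    linarith
  have hWr : (1 / 2 - ε / 4) * n ≤ (((n - m) - (n - m) / 2 : ℕ) : ℝ) := by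
    refine hUr.trans (Nat.cast_le.2 ?_)
    omega
  have hUle : (((n - m) / 2 : ℕ) : ℝ) ≤ n := by
    refine Nat.cast_le.2 ?_
    omega
  have hMpow : (3 * (q * n)) ^ (2 * k - 2) * (2 * ((2 * k) ^ 2 * Z)) ≤ θ * n := by
    rw [mul_pow]
    have h1 := mul_le_mul_of_nonneg_left hpow hQ0.le
    have h2 : Q * (θ / Q * n) = θ * n := by field_simp
    rw [h2, hQ] at h1
    linarith
  have hMp0 : 0 ≤ (3 * (q * n)) ^ (2 * k - 2) := by positivity
  have hkk : (2 * k : ℝ) ≤ (2 * k) ^ 2 := le_self_pow₀ (by linarith only [hk1]) two_ne_zero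
  have hMsucc : (3 * (q * n)) ^ (2 * k - 3) * (3 * (q * n)) = (3 * (q * n)) ^ (2 * k - 2) := by
    rw [← pow_succ]
    congr 1
    omega
  have key := graphProb_boundedChromaticEvent_le_half (p := p n) (hq ▸ hq0) P (C := C) (s := s)
    (M := 3 * (q * n)) hε0 hε1 hθ0 hτ0 (by rw [hq]) (by omega) (by omega)
    (by rw [hPU]; exact hUr) (by rw [hPW]; exact hWr)
    (by rw [hPD']; exact hθ1) (by rw [hPD]; exact hθ2) hθ3 (by rw [hτ]; exact le_of_eq (by ring))
    (by
      rw [hPk, hPD]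
      refine le_trans (le_of_eq_of_le ?_ (mul_le_mul_of_nonneg_left
        (mul_le_mul_of_nonneg_left (mul_le_mul hkk z1 (by positivity) (by positivity))
          zero_le_two) hMp0)) hMpow
      ring)
    (by
      rw [hPk, hPD, hPD']
      refine le_trans (le_of_eq_of_le ?_ (mul_le_mul_of_nonneg_left
        (mul_le_mul_of_nonneg_left (mul_le_mul_of_nonneg_left z4
          (by positivity : (0 : ℝ) ≤ (2 * k) ^ 2)) zero_le_two) hMp0)) hMpow
      rw [← hMsucc]
      ring)
    (by
      rw [hPk, hPD, hPD']
      refine le_trans (le_of_eq_of_le ?_ (mul_le_mul_of_nonneg_left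
        (mul_le_mul_of_nonneg_left (mul_le_mul (one_le_pow₀ (by linarith only [hk1]) : (1 : ℝ) ≤ (2 * k) ^ 2) z5
          (by positivity) (by positivity)) zero_le_two) hMp0)) hMpow
      ring)
    (by rw [← hq]; exact hnsq _ (by simpa using e1)) (by rw [← hq]; exact hnsq _ e2)
    (by rw [← hq]; exact e3) (by rw [← hq]; exact hnsq _ e4)
    (by
      rw [hPU, hPX, hPD', ← hq]
      have hD'p : (0 : ℝ) < D' := by exact_mod_cast hD'0
      rw [div_le_iff₀ hτ0] at hD'r
      calc (((n - m) / 2 : ℕ) : ℝ) * (m * q / D') / (τ * n)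
          ≤ n * ((K + 1) / D') / (τ * n) := by gcongr
        _ = (K + 1) / (D' * τ) := by field_simp
        _ ≤ 1 / 20 := by
            rw [div_le_div_iff₀ (by positivity) (by norm_num)]
            linarith)
    (by
      rw [hPX, hPD, ← hq]
      have hmp : (0 : ℝ) < m := lt_of_lt_of_le hR0 hmR
      have hDr : (D : ℝ) = 80 * (K + 1) := by rw [hD]; push_cast; ring
      calc (m : ℝ) * (m * q / (D + 1)) / (m / 4) = 4 * (m * q) / (D + 1) := by field_simp
        _ ≤ 1 / 20 := by
            rw [div_le_div_iff₀ (by positivity) (by norm_num), hDr]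
            linarith)
    (by
      rw [hPX, hPk, ← hq]
      have hmp : (0 : ℝ) < m := lt_of_lt_of_le hR0 hmR
      have h1 : (m * q) ^ (2 * k + 1) ≤ ((K : ℝ) + 1) ^ (2 * k + 1) := by gcongr
      have h2 : 80 * ((K : ℝ) + 1) ^ (2 * k + 1) ≤ m := by
        have : 80 * (K + 1) ^ (2 * k + 1) ≤ m := by omega
        exact_mod_cast this
      rw [div_le_iff₀ (by positivity)]
      linarith)
    (by
      rw [hPX, ← hq]
      have hm20 : 20 ≤ m := by
        have : 1 ≤ (K + 1) ^ (2 * k + 1) := Nat.one_le_pow _ _ (by omega)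
        omega
      refine two_pow_mul_one_sub_pow_choose_le hq0.le hq1 hC hm20 hsge hs1 ?_
      have hKr : (K : ℝ) = 128 * C ^ 2 := by rw [hK]; push_cast; ring
      linarith)
    (by rw [hPX]; exact hCs)
  rw [hPk] at key
  have hμ : d * (p n : ℝ) * (n : ℝ) = (1 / 2 - ε) * ((p n : ℝ) * n) := by rw [hε]; ring
  rw [hμ]
  exact key

open scoped Classical in
/-- Asymptotically almost surely, no subgraph has minimum degree at least `3 * p * n`, so the event
holds vacuously. -/
lemma tendsto_boundedChromaticEvent_three {W : Type*} (H : SimpleGraph W)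
    (hlower : ∀ᶠ n : ℕ in atTop, (Real.log (n : ℝ)) ^ 2 / (n : ℝ) ≤ (p n : ℝ)) :
    Tendsto (fun n : ℕ => SimpleGraph.binomialRandom (Fin n) (p n)
      (BoundedChromaticEvent H n (3 * (p n : ℝ) * (n : ℝ)) 1)) atTop (𝓝 1) := by
  have hlow : Tendsto (fun n : ℕ => ENNReal.ofReal (1 - 1 / (n : ℝ))) atTop (𝓝 1) := by
    have h1 : Tendsto (fun n : ℕ => 1 - 1 / (n : ℝ)) atTop (𝓝 (1 - 0)) :=
      tendsto_const_nhds.sub tendsto_one_div_atTop_nhds_zero_nat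
    simpa [Function.comp_def] using (ENNReal.continuous_ofReal.tendsto _).comp h1
  refine tendsto_of_tendsto_of_tendsto_of_le_of_le' hlow tendsto_const_nhds ?_
    (Eventually.of_forall fun n => MeasureTheory.prob_le_one)
  filter_upwards [eventually_sq_mul_exp_le hlower one_pos, eventually_gt_atTop 0] with n h hn0
  have : NeZero n := ⟨hn0.ne'⟩
  have hn : (0 : ℝ) < n := by exact_mod_cast hn0
  obtain ⟨E, hE⟩ : ∃ E, E = BoundedChromaticEvent H n (3 * (p n : ℝ) * (n : ℝ)) 1 := ⟨_, rfl⟩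
  rw [← hE]
  have hmax := graphProb_maxDegree_le (V := Fin n) (p := p n) (n := (n : ℝ)) (by simp)
  obtain ⟨B, hB⟩ : ∃ B, B = {Γ : SimpleGraph (Fin n) | ∃ a ∈ (Finset.univ : Finset (Fin n)),
    3 * ((p n : ℝ) * n) ≤ ((nbrIn Γ Finset.univ a).card : ℝ)} := ⟨_, rfl⟩
  rw [← hB] at hmax
  -- Without a vertex of degree `3 * p * n` in the random graph, no subgraph satisfies the degree
  -- condition.
  have hunion : E ∪ B = Set.univ := by
    rw [Set.eq_univ_iff_forall]
    intro Γ
    by_contra hcon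
    rw [Set.mem_union, not_or, hE, hB] at hcon
    refine hcon.1 fun G hG _ hdeg => absurd ?_ hcon.2
    refine ⟨0, Finset.mem_univ _, ?_⟩
    rw [← mul_assoc]
    refine hdeg.trans (Nat.cast_le.2 ((SimpleGraph.minDegree_le_degree G 0).trans ?_))
    rw [← SimpleGraph.card_neighborFinset_eq_degree]
    refine Finset.card_le_card fun b hb => mem_nbrIn.2 ⟨Finset.mem_univ _, hG ?_⟩
    simpa using hb
  have h1 := graphProb_union_le (p := p n) E B
  have h2 : graphProb (p n) (E ∪ B) = 1 := by rw [hunion, graphProb]; simp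
  have h3 : (n : ℝ) * Real.exp (-((p n : ℝ) * n)) ≤ 1 / n := by
    rw [le_div_iff₀ hn]
    rw [one_mul] at h
    linarith
  have h4 : 1 - 1 / (n : ℝ) ≤ graphProb (p n) E := by linarith
  rw [graphProb, MeasureTheory.measureReal_def] at h4
  exact ENNReal.ofReal_le_of_le_toReal h4

end Main

theorem proposition4p6 (k : ℕ) (hk : 2 ≤ k) (p : ℕ → unitInterval)
    (hlower : ∀ᶠ n : ℕ in atTop, (Real.log (n : ℝ)) ^ 2 / (n : ℝ) ≤ (p n : ℝ))
    (hupper : (fun n : ℕ => (p n : ℝ)) =o[atTop]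
      (fun n : ℕ => (n : ℝ) ^ (-((2 * (k : ℝ) - 3) / (2 * (k : ℝ) - 2))))) :
    (1 / 2 : ℝ) ≤ chromaticThreshold (SimpleGraph.cycleGraph (2 * k + 1)) p := by
  -- The real infimum of the empty set is 0, so an admissible value has to be exhibited; 3 is
  -- admissible vacuously.
  refine le_csInf ⟨3, by norm_num, 1, one_pos, tendsto_boundedChromaticEvent_three _ hlower⟩ ?_
  rintro d ⟨hd0, C, hC, hlim⟩
  by_contra! hd
  have h1 := eventually_graphProb_le_half hk hlower hupper hd0 hd hC
  have h2 := hlim.eventually (lt_mem_nhds (a := ENNReal.ofReal (1 / 2)) (by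
    rw [ENNReal.ofReal_lt_one]; norm_num))
  obtain ⟨n, hn1, hn2⟩ := (h1.and h2).exists
  rw [graphProb, MeasureTheory.measureReal_def] at hn1
  have := (ENNReal.ofReal_lt_iff_lt_toReal (by norm_num) (MeasureTheory.measure_ne_top _ _)).1 hn2
  linarith
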